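/- Let $F$ be a field and let $A$ be a central simple $F$-algebra of degree $n$, i.e. $\dim_F A = n^2$. Let $\acute{e}t_n(A)$ be the moduli space of maximal étale subalgebras of $A$: the functor which sends an $F$-scheme $Y$ to the set of sheaves of commutative (finite) étale subalgebras $E \subset A_Y = \mathcal{O}_Y \otimes_F A$ of type $[1,\dots,1]$ ($n$ ones). Here $E$ has type $[n_1,\dots,n_m]$ if at every geometric point $\operatorname{Spec}\Omega \to Y$ one has $E_\Omega = \bigoplus_{i=1}^m \Omega e_i$ with nonzero orthogonal idempotents $e_i$ of sum $1$ such that the right ideals $e_i A_\Omega$ have reduced dimensions $\dim_\Omega(e_iA_\Omega)/n = n_i$ (up to order). Two $F$-points $p,q$ of an $F$-scheme $X$ (or of a functor $X$ on $F$-schemes) are called elementarily linked if there is a rational morphism $\varphi : \mathbb{P}^1_F \dashrightarrow X$, that is, a morphism $\varphi : U \to X$ (for a functor: an element $\varphi \in X(U)$) on a dense open subscheme $U \subset \mathbb{P}^1_F$, such that $p = \varphi(a)$ and $q = \varphi(b)$ for some $a,b \in U(F)$. R-equivalence is the equivalence relation on $X(F)$ generated by this relation, and $X$ is called R-trivial if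 $X(F)/R$ has exactly one element. Then $\acute{e}t_n(A)$ is R-trivial. In other words, the functor $\acute{e}t_n(A)$ is R-trivial, and so is every $F$-scheme that represents it (the moduli variety). -/

import Mathlib

open CategoryTheory AlgebraicGeometry Opposite
open scoped TensorProduct

universe u

noncomputable section

/-! ### R-equivalence -/

section REquivalence

variable (F : Type u) [Field F]

/-- The projective line over `F`, i.e. `Proj F[x₀, x₁]`, as a scheme over `Spec F`. -/
def projLine : Over (Spec (CommRingCat.of F)) :=
  letI := MvPolynomial.gradedAlgebra (σ := Fin 2) (R := F)
  Over.mk (Proj.toSpecZero (MvPolynomial.homogeneousSubmodule (Fin 2) F) ≫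
    Spec.map (CommRingCat.ofHom
      (algebraMap F (MvPolynomial.homogeneousSubmodule (Fin 2) F 0))))

variable {F}

/-- An open subscheme of an `F`-scheme, as an `F`-scheme. -/
def openOver (Y : Over (Spec (CommRingCat.of F))) (U : Y.left.Opens) :
    Over (Spec (CommRingCat.of F)) :=
  Over.mk (U.ι ≫ Y.hom)

variable (F) in
/-- `Spec F` as an `F`-scheme. -/
def baseOver : Over (Spec (CommRingCat.of F)) := Over.mk (𝟙 (Spec (CommRingCat.of F)))

/-- Two `F`-points `p`, `q` of a functor `G` on `F`-schemes are elementarily linked if both are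
values at `F`-points of one rational morphism from the projective line to `G`, i.e. of a morphism
(by Yoneda: an element `φ` of `G U`) that is defined on a dense open subscheme `U`. For
`G = yoneda.obj X` these are the rational morphisms from the projective line to the scheme `X`. -/
def ElementarilyLinked (G : (Over (Spec (CommRingCat.of F)))ᵒᵖ ⥤ Type*)
    (p q : G.obj (op (baseOver F))) : Prop :=
  ∃ (U : (projLine F).left.Opens) (_ : Dense (U : Set (projLine F).left))
    (φ : G.obj (op (openOver (projLine F) U)))
    (a b : baseOver F ⟶ openOver (projLine F) U),
    G.map a.op φ = p ∧ G.map b.op φ = q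

/-- R-equivalence: the equivalence relation generated by elementary linkage. -/
def rEquiv (G : (Over (Spec (CommRingCat.of F)))ᵒᵖ ⥤ Type*) :
    Setoid (G.obj (op (baseOver F))) :=
  Relation.EqvGen.setoid (ElementarilyLinked G)

/-- `G` is R-trivial if `G(F)/R` has exactly one element. -/
def IsRTrivial (G : (Over (Spec (CommRingCat.of F)))ᵒᵖ ⥤ Type*) : Prop :=
  Nat.card (Quotient (rEquiv G)) = 1

/-- R-triviality of an `F`-scheme. -/
def SchemeIsRTrivial (X : Over (Spec (CommRingCat.of F))) : Prop :=
  IsRTrivial (yoneda.obj X)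

end REquivalence

/-! ### Étale subalgebras -/

section Etale

/-- A subalgebra `E` of a (not necessarily commutative) `R`-algebra `B` is a commutative étale
subalgebra if it is commutative, finite and étale over `R`, and a direct summand of `B`, so that
it remains a subalgebra after every change of the base. -/
def IsEtaleSubalgebra {R B : Type u} [CommRing R] [Ring B] [Algebra R B]
    (E : Subalgebra R B) : Prop :=
  (∃ C : Submodule R B, IsCompl (Subalgebra.toSubmodule E) C) ∧
  ∃ (S : Type u) (_ : CommRing S) (_ : Algebra R S),
    Algebra.Etale R S ∧ Module.Finite R S ∧ Nonempty (S ≃ₐ[R] E)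

/-- The type of a split commutative subalgebra `E = ⊕ Ω eᵢ`, with `eᵢ` its minimal idempotents, of
an algebra `B` of degree `n` over `Ω`: the unordered collection of the reduced ranks
`dim (eᵢ B) / n` of the right ideals `eᵢ B`. -/
def HasGeometricType {Ω B : Type*} [Field Ω] [Ring B] [Algebra Ω B] (n : ℕ)
    (E : Subalgebra Ω B) (ρ : Multiset ℕ) : Prop :=
  ∃ (m : ℕ) (e : Fin m → B) (r : Fin m → ℕ),
    CompleteOrthogonalIdempotents e ∧ (∀ i, e i ≠ 0) ∧
    Submodule.span Ω (Set.range e) = Subalgebra.toSubmodule E ∧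
    (∀ i, Module.finrank Ω (LinearMap.range (LinearMap.mulLeft Ω (e i))) = n * r i) ∧
    Multiset.map r Finset.univ.val = ρ

variable {F : Type u} [Field F] {A : Type u} [Ring A] [Algebra F A]

/-- The pullback along `g : R → R'` of a subalgebra of `A_R = R ⊗ A`: the subalgebra of `A_{R'}`
generated by its image. -/
def pullbackSubalgebra {R R' : Type u} [CommRing R] [Algebra F R] [CommRing R'] [Algebra F R']
    (g : R →ₐ[F] R') (E : Subalgebra R (R ⊗[F] A)) : Subalgebra R' (R' ⊗[F] A) :=
  Algebra.adjoin R' (Algebra.TensorProduct.map g (AlgHom.id F A) '' (E : Set (R ⊗[F] A)))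

lemma pullbackSubalgebra_id {R : Type u} [CommRing R] [Algebra F R]
    (E : Subalgebra R (R ⊗[F] A)) : pullbackSubalgebra (AlgHom.id F R) E = E := by
  unfold pullbackSubalgebra
  simp [Algebra.adjoin_eq]

lemma pullbackSubalgebra_comp {R R' R'' : Type u} [CommRing R] [Algebra F R] [CommRing R']
    [Algebra F R'] [CommRing R''] [Algebra F R''] (g : R →ₐ[F] R') (h : R' →ₐ[F] R'')
    (E : Subalgebra R (R ⊗[F] A)) :
    pullbackSubalgebra (h.comp g) E = pullbackSubalgebra h (pullbackSubalgebra g E) := by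
  have key : ∀ x, Algebra.TensorProduct.map (h.comp g) (AlgHom.id F A) x =
      Algebra.TensorProduct.map h (AlgHom.id F A)
        (Algebra.TensorProduct.map g (AlgHom.id F A) x) := by
    intro x
    induction x with
    | zero => simp
    | tmul a b => simp
    | add a b ha hb => simp [ha, hb]
  have hs : ∀ (r : R') (x : R' ⊗[F] A), Algebra.TensorProduct.map h (AlgHom.id F A) (r • x) =
      h r • Algebra.TensorProduct.map h (AlgHom.id F A) x := by
    intro r x
    induction x with
    | zero => simp
    | tmul a b => simp [TensorProduct.smul_tmul']
    | add a b ha hb => simp only [smul_add, map_add, ha, hb]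
  apply le_antisymm
  · refine Algebra.adjoin_le ?_
    rintro _ ⟨x, hx, rfl⟩
    rw [key]
    exact Algebra.subset_adjoin ⟨_, Algebra.subset_adjoin ⟨x, hx, rfl⟩, rfl⟩
  · refine Algebra.adjoin_le ?_
    rintro _ ⟨y, hy, rfl⟩
    change y ∈ Algebra.adjoin R' _ at hy
    induction hy using Algebra.adjoin_induction with
    | mem y hy =>
      obtain ⟨x, hx, rfl⟩ := hy
      rw [← key]
      exact Algebra.subset_adjoin ⟨x, hx, rfl⟩
    | algebraMap r =>
      rw [Algebra.algebraMap_eq_smul_one, hs, map_one]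
      exact Subalgebra.smul_mem _ (one_mem _) _
    | add a b _ _ ha hb => rw [map_add]; exact add_mem ha hb
    | mul a b _ _ ha hb => rw [map_mul]; exact mul_mem ha hb

lemma IsEtaleSubalgebra.pullback {R R' : Type u} [CommRing R] [Algebra F R] [CommRing R']
    [Algebra F R'] (g : R →ₐ[F] R') {E : Subalgebra R (R ⊗[F] A)} (hE : IsEtaleSubalgebra E) :
    IsEtaleSubalgebra (pullbackSubalgebra g E) := by
  obtain ⟨⟨C, hC⟩, S, _, _, hS, hfin, ⟨e⟩⟩ := hE
  let _ : Algebra R R' := g.toRingHom.toAlgebra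
  have _ : IsScalarTower F R R' := IsScalarTower.of_algebraMap_eq fun x => (g.commutes x).symm
  let G : R ⊗[F] A →ₐ[R] R' ⊗[F] A :=
    Algebra.TensorProduct.map (Algebra.ofId R R') (AlgHom.id F A)
  have hG : ∀ y, G y = Algebra.TensorProduct.map g (AlgHom.id F A) y := by
    intro y
    induction y with
    | zero => simp
    | tmul a b => rfl
    | add a b ha hb => rw [map_add, map_add, ha, hb]
  let c : R' ⊗[R] (R ⊗[F] A) ≃ₗ[R'] R' ⊗[F] A :=
    TensorProduct.AlgebraTensorModule.cancelBaseChange F R R' R' A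
  have hc : ∀ y, c (1 ⊗ₜ y) = G y := by
    intro y
    induction y with
    | zero => simp
    | tmul a b =>
      simp [c, G, Algebra.ofId_apply, Algebra.smul_def]
    | add a b ha hb => simp only [TensorProduct.tmul_add, map_add, ha, hb]
  let j : S →ₐ[R] R ⊗[F] A := E.val.comp e.toAlgHom
  let J : R' ⊗[R] S →ₐ[R'] R' ⊗[F] A :=
    Algebra.TensorProduct.lift (Algebra.ofId R' _) (G.comp j)
      fun r s => Algebra.commutes r (G (j s))
  let p : R ⊗[F] A →ₗ[R] S :=
    e.symm.toLinearMap ∘ₗ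
      (Submodule.projectionOnto (Subalgebra.toSubmodule E) C hC : R ⊗[F] A →ₗ[R] E)
  have hp : ∀ s, p (j s) = s := by
    intro s
    have h := Submodule.projectionOnto_apply_left hC (e s)
    exact (congrArg e.symm h).trans (e.symm_apply_apply s)
  let P : R' ⊗[F] A →ₗ[R'] R' ⊗[R] S :=
    (LinearMap.baseChange R' p) ∘ₗ c.symm.toLinearMap
  have hJ' : ∀ (r : R') (s : S), J (r ⊗ₜ s) = r • G (j s) := by
    intro r s
    rw [Algebra.smul_def]
    exact Algebra.TensorProduct.lift_tmul _ _ _ _ _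
  have hJ : ∀ (r : R') (s : S), J (r ⊗ₜ s) =
      r • Algebra.TensorProduct.map g (AlgHom.id F A) (j s) := by
    intro r s
    rw [hJ', hG]
  have hP : ∀ x, P (J x) = x := by
    intro x
    induction x with
    | zero => simp
    | tmul r s =>
      rw [hJ', map_smul, ← hc]
      change r • LinearMap.baseChange R' p (c.symm (c _)) = _
      rw [LinearEquiv.symm_apply_apply, LinearMap.baseChange_tmul, hp, TensorProduct.smul_tmul',
        smul_eq_mul, mul_one]
    | add a b ha hb => rw [map_add, map_add, ha, hb]
  have hrange : J.range = pullbackSubalgebra g E := by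
    apply le_antisymm
    · rintro _ ⟨x, rfl⟩
      change J x ∈ _
      induction x with
      | zero => rw [map_zero]; exact zero_mem _
      | tmul r s =>
        rw [hJ]
        exact Subalgebra.smul_mem _ (Algebra.subset_adjoin (Set.mem_image_of_mem _ (e s).2)) _
      | add a b ha hb => rw [map_add]; exact add_mem ha hb
    · refine Algebra.adjoin_le ?_
      rintro _ ⟨x, hx, rfl⟩
      have h : J ((1 : R') ⊗ₜ[R] e.symm ⟨x, hx⟩) =
          Algebra.TensorProduct.map g (AlgHom.id F A) x := by
        rw [hJ, one_smul]
        simp [j]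
      exact h ▸ J.mem_range_self _
  rw [← hrange]
  let Q : R' ⊗[F] A →ₗ[R'] Subalgebra.toSubmodule J.range := J.rangeRestrict.toLinearMap ∘ₗ P
  refine ⟨⟨LinearMap.ker Q, ?_⟩, R' ⊗[R] S, inferInstance,
    inferInstance, inferInstance, inferInstance,
    ⟨AlgEquiv.ofInjective J (Function.LeftInverse.injective hP)⟩⟩
  refine LinearMap.isCompl_of_proj (f := Q) ?_
  rintro ⟨_, x, rfl⟩
  apply Subtype.ext
  change J (P (J x)) = J x
  rw [hP]

variable (F A) in
/-- The étale subalgebras of type `ρ` of `A_R`, for a central simple `F`-algebra `A` of degree `n`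
and a commutative `F`-algebra `R`, as a functor of `R`. The type is tested at all geometric points
of `Spec R`. -/
def etaleSubalgebras (n : ℕ) (ρ : Multiset ℕ) : CommAlgCat.{u} F ⥤ Type u where
  obj R := {E : Subalgebra R (R ⊗[F] A) // IsEtaleSubalgebra E ∧
    ∀ (Ω : Type u) [Field Ω] [IsAlgClosed Ω] [Algebra F Ω] (x : R →ₐ[F] Ω),
      HasGeometricType n (pullbackSubalgebra x E) ρ}
  map g := ↾fun E => ⟨pullbackSubalgebra g.hom E.1, E.2.1.pullback g.hom, fun Ω _ _ _ x => by
    rw [← pullbackSubalgebra_comp]; exact E.2.2 Ω _⟩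
  map_id R := by
    ext E : 3
    exact Subtype.ext (pullbackSubalgebra_id E.1)
  map_comp g h := by
    ext E : 3
    exact Subtype.ext (pullbackSubalgebra_comp g.hom h.hom E.1)

variable (F A) in
/-- The functor that sends an `F`-scheme `Y` to the set of sheaves of étale subalgebras of type `ρ`
of `A_Y`. Such a sheaf is given by its pullbacks to all affine `F`-schemes `Spec R → Y`, which are
étale subalgebras of `A_R` compatible with all changes of `R`: it is a natural transformation
from the functor `R ↦ Y(R)` to `etaleSubalgebras F A n ρ`. -/
def etaleSubalgebraSheaves (n : ℕ) (ρ : Multiset ℕ) : (Over (Spec (CommRingCat.of F)))ᵒᵖ ⥤ Type (u + 1) :=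
  (yoneda ⋙ (Functor.whiskeringLeft _ _ _).obj (algSpec (CommRingCat.of F)).rightOp).op ⋙
    yoneda.obj (etaleSubalgebras F A n ρ)

variable (F A) in
/-- `ét_m(A)`, for `m` dividing `n = deg A`: the moduli of étale subalgebras of type
`[n/m, …, n/m]` (`m` terms). -/
def et (n m : ℕ) : (Over (Spec (CommRingCat.of F)))ᵒᵖ ⥤ Type (u + 1) :=
  etaleSubalgebraSheaves F A n (Multiset.replicate m (n / m))

end Etale

end

/-!
An element of `ét_n(A)` over `Spec R` is an étale subalgebra of `R ⊗ A` whose geometric fibres have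
type `[1, …, 1]`. When `n` is the degree of `A`, the type is automatic for étale subalgebras of
rank `n`: over an algebraically closed field such a subalgebra is spanned by `n` orthogonal
idempotents, a nonzero right ideal of a matrix algebra of degree `n` has dimension at least `n`, and
the `n` right ideals in question have total dimension `n ^ 2` (`IsEtaleSubalgebra.hasGeometricType`).
The affine open subsets `Spec F[t]_h` of the line are dense open subschemes of the projective line,
so it suffices to join any two étale subalgebras of rank `n` by a chain of étale families of rank
`n` over such subsets, with the given members at `t = 0` and `t = 1`, and to find one étale
subalgebra of rank `n` (`isRTrivial_et`).

If `F` is infinite, every étale subalgebra of rank `n` is generated by one element, and one line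
suffices. Let `x₀` and `x₁` generate two of them and put `x = (1 - t) x₀ + t x₁`. By the
Cayley–Hamilton theorem `1, x, …, x ^ n` are linearly dependent, and Cramer's rule with respect to
`n` functionals, themselves interpolated between the functionals dual to the powers of `x₀` and
`x₁`, gives a polynomial over `F[t]` with root `x` that specializes to the minimal polynomials of
`x₀` and `x₁` (`cramerPoly`, `cramerPoly_specialize`). Where its leading coefficient and its
discriminant do not vanish, which includes `0` and `1`, the element `x` generates an étale
subalgebra of rank `n` (`subalgebraLinked_adjoin`). One such subalgebra exists because the
discriminant of the generic characteristic polynomial is not zero (`exists_minpoly_separable`).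

If `F` is finite, étale subalgebras need not have generators, but `A` is a matrix algebra. An étale
subalgebra of rank `n` has a cyclic vector, so it is an abstract étale algebra `S` acting on itself,
written in some basis (`IsEtaleSubalgebra.exists_eq_range_mulEmbedding`). The basis does not matter,
since two bases can be joined by a line (`subalgebraLinked_of_basis`). The algebra can be varied: the
line through two separable polynomials `f` and `g` of the same degree joins `F[X] / (f) × T` to
`F[X] / (g) × T` for every étale algebra `T` (`algConnected_adjoinRoot_prod`). By the Chinese
remainder theorem every product of finite extension fields of `F` can be transformed in this way,
factor by factor, into `F[X] / (f)` for a given separable `f`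
(`connectedToAdjoinRoot_of_etale`); this uses separable polynomials of any given degree that are
coprime to a given irreducible polynomial (`exists_separable_isCoprime`).
-/

noncomputable section

/-! ### Rational curves on a functor -/

section Line

variable (F : Type u) [Field F]

open Polynomial

attribute [local instance] MvPolynomial.gradedAlgebra

/-- The coordinate ring of the affine chart `x₀ ≠ 0` of the projective line. -/
abbrev ChartRing : Type u :=
  HomogeneousLocalization.Away (MvPolynomial.homogeneousSubmodule (Fin 2) F)
    (MvPolynomial.X 0)

/-- The structure map of `ChartRing F` as an `F`-algebra. -/
def chartConst : F →+* ChartRing F :=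
  (HomogeneousLocalization.fromZeroRingHom (MvPolynomial.homogeneousSubmodule (Fin 2) F) _).comp
    (algebraMap F (MvPolynomial.homogeneousSubmodule (Fin 2) F 0))

lemma X_mem_homogeneousSubmodule (i : Fin 2) :
    MvPolynomial.X i ∈ MvPolynomial.homogeneousSubmodule (Fin 2) F 1 :=
  (MvPolynomial.mem_homogeneousSubmodule _ _).mpr (MvPolynomial.isHomogeneous_X F i)

/-- The map `F[t] → ChartRing F` that sends `t` to the affine coordinate `x₁ / x₀`. -/
def chartOfPoly : F[X] →+* ChartRing F :=
  eval₂RingHom (chartConst F) (HomogeneousLocalization.Away.mk _ (d := 1)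
    (X_mem_homogeneousSubmodule F 0) 1 (MvPolynomial.X 1)
    (by rw [one_smul]; exact X_mem_homogeneousSubmodule F 1))

/-- Dehomogenization `ChartRing F → F[t]`, with `x₀ ↦ 1` and `x₁ ↦ t`. -/
def polyOfChart : ChartRing F →+* F[X] :=
  (IsLocalization.Away.lift (S := Localization.Away (MvPolynomial.X 0 : MvPolynomial (Fin 2) F))
    (MvPolynomial.X 0 : MvPolynomial (Fin 2) F)
    (g := (MvPolynomial.aeval (R := F) ![1, (X : F[X])]).toRingHom) (by simp)).comp
    (algebraMap (ChartRing F) _)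

lemma polyOfChart_chartConst (c : F) : polyOfChart F (chartConst F c) = C c := by
  have h1 : algebraMap (ChartRing F)
      (Localization.Away (MvPolynomial.X 0 : MvPolynomial (Fin 2) F)) (chartConst F c) =
      algebraMap (MvPolynomial (Fin 2) F) _ (MvPolynomial.C c) := by
    rw [HomogeneousLocalization.algebraMap_apply]
    simp [chartConst, HomogeneousLocalization.fromZeroRingHom, ← Localization.mk_one_eq_algebraMap]
    rfl
  rw [polyOfChart, RingHom.comp_apply, h1, IsLocalization.Away.lift_eq]
  simp

lemma polyOfChart_comp_chartOfPoly : (polyOfChart F).comp (chartOfPoly F) = RingHom.id F[X] := by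
  refine Polynomial.ringHom_ext (fun a => ?_) ?_
  · simp [chartOfPoly, polyOfChart_chartConst]
  · simp only [chartOfPoly, RingHom.comp_apply, coe_eval₂RingHom, eval₂_X, RingHom.id_apply]
    rw [polyOfChart, RingHom.comp_apply, HomogeneousLocalization.algebraMap_apply,
      HomogeneousLocalization.Away.val_mk, Localization.mk_eq_mk',
      IsLocalization.Away.lift, IsLocalization.lift_mk'_spec]
    simp

/-- The zero ideal is a point of the projective line, and it lies in every nonempty open subset. -/
lemma dense_opens_projLine (U : (projLine F).left.Opens)
    (hU : (U : Set (projLine F).left).Nonempty) :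
    Dense (U : Set (projLine F).left) := by
  let 𝒜 := MvPolynomial.homogeneousSubmodule (Fin 2) F
  let η : ProjectiveSpectrum 𝒜 := ⟨⊥, by
      rw [HomogeneousIdeal.toIdeal_bot]; exact Ideal.isPrime_bot, fun h => by
      have h0 : (MvPolynomial.X 0 : MvPolynomial (Fin 2) F) ∈ HomogeneousIdeal.irrelevant 𝒜 := by
        rw [HomogeneousIdeal.mem_irrelevant_iff, GradedRing.proj_apply,
          DirectSum.decompose_of_mem_ne 𝒜 (X_mem_homogeneousSubmodule F 0) (by simp)]
      have h1 := h h0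
      exact MvPolynomial.X_ne_zero _ (show (MvPolynomial.X 0 : MvPolynomial (Fin 2) F) = 0 from
        (HomogeneousIdeal.mem_iff.mp h1))⟩
  have key : ∀ V : (Proj 𝒜).Opens, (V : Set (Proj 𝒜)).Nonempty → (η : Proj 𝒜) ∈ V := by
    rintro V ⟨x, hx⟩
    obtain ⟨_, ⟨_, ⟨f, rfl⟩, rfl⟩, hxf, hfV⟩ := (Proj.isBasis_basicOpen 𝒜).exists_subset_of_mem_open
      hx V.isOpen
    refine hfV ((Proj.mem_basicOpen 𝒜 f η).mpr fun h => ?_)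
    have hf : f = 0 := HomogeneousIdeal.mem_iff.mp h
    simp [hf] at hxf
  rw [dense_iff_inter_open]
  intro V hV hne
  exact ⟨η, key ⟨V, hV⟩ hne, key U hU⟩

variable {F}

/-- The localization of the chart ring at `h(t)`. -/
abbrev ChartAway (h : F[X]) : Type u := Localization.Away (chartOfPoly F h)

/-- The map `F[t]_h → (ChartRing F)_h` induced by `chartOfPoly`. -/
def chartAwayOfAway (h : F[X]) : Localization.Away h →+* ChartAway h :=
  IsLocalization.Away.lift h (g := (algebraMap (ChartRing F) (ChartAway h)).comp (chartOfPoly F))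
    (IsLocalization.Away.algebraMap_isUnit (chartOfPoly F h))

lemma polyOfChart_chartOfPoly (f : F[X]) : polyOfChart F (chartOfPoly F f) = f :=
  congrArg (fun g : F[X] →+* F[X] => g f) (polyOfChart_comp_chartOfPoly F)

/-- Evaluation at the `F`-point `s` of the line, on the localization of `F[t]` at a polynomial that
does not vanish at `s`. -/
def evalAway (h : F[X]) (s : F) (hs : h.eval s ≠ 0) : Localization.Away h →ₐ[F] F :=
  IsLocalization.Away.liftAlgHom h (f := (aeval s : F[X] →ₐ[F] F))
    (by simpa [coe_aeval_eq_eval] using hs)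

lemma evalAway_algebraMap (h : F[X]) (s : F) (hs : h.eval s ≠ 0) (f : F[X]) :
    evalAway h s hs (algebraMap F[X] _ f) = f.eval s := by
  simp [evalAway]

/-- Evaluation at the `F`-point `s` of the line, on the chart of the projective line. -/
def evalChart (h : F[X]) (s : F) (hs : h.eval s ≠ 0) : ChartAway h →+* F :=
  IsLocalization.Away.lift (chartOfPoly F h) (g := (evalRingHom s).comp (polyOfChart F))
    (by simpa [polyOfChart_chartOfPoly] using hs)

lemma evalChart_comp (h : F[X]) (s : F) (hs : h.eval s ≠ 0) :
    (evalChart h s hs).comp (chartAwayOfAway h) = (evalAway h s hs).toRingHom := by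
  refine IsLocalization.ringHom_ext (Submonoid.powers h) (RingHom.ext fun f => ?_)
  simp [chartAwayOfAway, evalChart, polyOfChart_chartOfPoly, evalAway_algebraMap]

/-- The open immersion of the spectrum of `ChartAway h` into the projective line. -/
def chartImmersion (h : F[X]) : Spec (CommRingCat.of (ChartAway h)) ⟶
    Proj (MvPolynomial.homogeneousSubmodule (Fin 2) F) :=
  Spec.map (CommRingCat.ofHom (algebraMap (ChartRing F) (ChartAway h))) ≫
    Proj.awayι (MvPolynomial.homogeneousSubmodule (Fin 2) F) (MvPolynomial.X 0)
      (X_mem_homogeneousSubmodule F 0) one_pos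

instance (h : F[X]) : IsOpenImmersion (chartImmersion h) := by
  have : IsOpenImmersion (Spec.map (CommRingCat.ofHom
    (algebraMap (ChartRing F) (ChartAway h)))) :=
    IsOpenImmersion.of_isLocalization (chartOfPoly F h)
  unfold chartImmersion
  infer_instance

/-- The open subset of the projective line on which the affine coordinate is defined and `h` does
not vanish. -/
def lineOpen (h : F[X]) : (projLine F).left.Opens := (chartImmersion h).opensRange

lemma chartImmersion_hom (h : F[X]) :
    chartImmersion h ≫ Proj.toSpecZero (MvPolynomial.homogeneousSubmodule (Fin 2) F) ≫
      Spec.map (CommRingCat.ofHom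
        (algebraMap F (MvPolynomial.homogeneousSubmodule (Fin 2) F 0))) =
    Spec.map (CommRingCat.ofHom
      ((algebraMap (ChartRing F) (ChartAway h)).comp (chartConst F))) := by
  unfold chartImmersion
  rw [Category.assoc, Proj.awayι_toSpecZero_assoc, ← Spec.map_comp, ← Spec.map_comp]
  rfl

lemma chartAwayOfAway_algebraMap (h : F[X]) (c : F) :
    chartAwayOfAway h (algebraMap F (Localization.Away h) c) =
      algebraMap (ChartRing F) (ChartAway h) (chartConst F c) := by
  rw [IsScalarTower.algebraMap_apply F F[X] (Localization.Away h)]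
  simp [chartAwayOfAway, chartOfPoly]

lemma lineRetraction_aux (h : F[X]) :
    ((chartImmersion h).isoOpensRange.inv ≫ Spec.map (CommRingCat.ofHom
      (chartAwayOfAway h))) ≫ Spec.map (CommRingCat.ofHom (algebraMap F (Localization.Away h))) =
      (chartImmersion h).opensRange.ι ≫
        Proj.toSpecZero (MvPolynomial.homogeneousSubmodule (Fin 2) F) ≫
      Spec.map (CommRingCat.ofHom
        (algebraMap F (MvPolynomial.homogeneousSubmodule (Fin 2) F 0))) := by
  rw [← Scheme.Hom.isoOpensRange_inv_comp, Category.assoc, Category.assoc, chartImmersion_hom,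
    ← Spec.map_comp, ← CommRingCat.ofHom_comp]
  congr 3
  exact RingHom.ext fun c => chartAwayOfAway_algebraMap h c

/-- The map from the open subset of the projective line to the spectrum of `F[t]_h`. -/
def lineRetraction (h : F[X]) : openOver (projLine F) (lineOpen h) ⟶
    (algSpec (CommRingCat.of F)).obj (op (CommAlgCat.of F (Localization.Away h))) :=
  Over.homMk ((chartImmersion h).isoOpensRange.inv ≫ Spec.map (CommRingCat.ofHom
    (chartAwayOfAway h))) (lineRetraction_aux h)

lemma linePoint_aux (h : F[X]) (s : F) (hs : h.eval s ≠ 0) :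
    (Spec.map (CommRingCat.ofHom (evalChart h s hs)) ≫ (chartImmersion h).isoOpensRange.hom) ≫
      (chartImmersion h).opensRange.ι ≫
        Proj.toSpecZero (MvPolynomial.homogeneousSubmodule (Fin 2) F) ≫
      Spec.map (CommRingCat.ofHom
        (algebraMap F (MvPolynomial.homogeneousSubmodule (Fin 2) F 0))) =
      𝟙 (Spec (CommRingCat.of F)) := by
  rw [← Scheme.Hom.isoOpensRange_inv_comp, Category.assoc, Category.assoc,
      Iso.hom_inv_id_assoc, chartImmersion_hom, ← Spec.map_comp, ← Spec.map_id]
  congr 1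
  ext c
  simp [evalChart, polyOfChart_chartConst]

/-- The `F`-point `s` of the open subset of the projective line. -/
def linePoint (h : F[X]) (s : F) (hs : h.eval s ≠ 0) :
    baseOver F ⟶ openOver (projLine F) (lineOpen h) :=
  Over.homMk (Spec.map (CommRingCat.ofHom (evalChart h s hs)) ≫
    (chartImmersion h).isoOpensRange.hom) (linePoint_aux h s hs)

/-- The morphism of `F`-schemes from `Spec F` to `Spec R` given by an `F`-point of `R`. -/
def specPoint {R : Type u} [CommRing R] [Algebra F R] (e : R →ₐ[F] F) :
    baseOver F ⟶ (algSpec (CommRingCat.of F)).obj (op (CommAlgCat.of F R)) :=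
  Over.homMk (Spec.map (CommRingCat.ofHom e.toRingHom)) (by
    refine (Spec.map_comp (CommRingCat.ofHom (algebraMap F R))
      (CommRingCat.ofHom e.toRingHom)).symm.trans ?_
    refine Eq.trans ?_ (Spec.map_id (CommRingCat.of F))
    congr 1
    ext c
    simp)

lemma linePoint_lineRetraction_aux (h : F[X]) (s : F) (hs : h.eval s ≠ 0) :
    (Spec.map (CommRingCat.ofHom (evalChart h s hs)) ≫ (chartImmersion h).isoOpensRange.hom) ≫
      (chartImmersion h).isoOpensRange.inv ≫ Spec.map (CommRingCat.ofHom (chartAwayOfAway h)) =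
    Spec.map (CommRingCat.ofHom (evalAway h s hs).toRingHom) := by
  rw [Category.assoc, Iso.hom_inv_id_assoc, ← Spec.map_comp, ← CommRingCat.ofHom_comp,
    evalChart_comp]

lemma linePoint_lineRetraction (h : F[X]) (s : F) (hs : h.eval s ≠ 0) :
    linePoint h s hs ≫ lineRetraction h = specPoint (evalAway h s hs) :=
  Over.OverMorphism.ext (linePoint_lineRetraction_aux h s hs)

/-- Two values of a family over the spectrum of `F[t]_h` at `F`-points are elementarily linked. -/
lemma elementarilyLinked_specPoint (G : (Over (Spec (CommRingCat.of F)))ᵒᵖ ⥤ Type*) (h : F[X])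
    (φ : G.obj (op ((algSpec (CommRingCat.of F)).obj (op (CommAlgCat.of F (Localization.Away h))))))
    (s t : F) (hs : h.eval s ≠ 0) (ht : h.eval t ≠ 0) :
    ElementarilyLinked G (G.map (specPoint (evalAway h s hs)).op φ)
      (G.map (specPoint (evalAway h t ht)).op φ) := by
  refine ⟨lineOpen h, dense_opens_projLine F _ ?_,
    G.map (lineRetraction h).op φ, linePoint h s hs, linePoint h t ht, ?_, ?_⟩
  · obtain ⟨x⟩ : Nonempty (Spec (CommRingCat.of F)) :=
      inferInstanceAs (Nonempty (PrimeSpectrum F))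
    exact ⟨_, ((linePoint h s hs).left x).2⟩
  all_goals rw [← linePoint_lineRetraction, op_comp, Functor.map_comp]; rfl

end Line

/-! ### Points of the moduli functor and of schemes that represent it -/

section Points

variable {F : Type u} [Field F]

/-- The isomorphism of `Spec F`, as the spectrum of the `F`-algebra `F`, with the final
`F`-scheme. -/
def specSelf : (algSpec (CommRingCat.of F)).obj (op (CommAlgCat.of F F)) ⟶ baseOver F :=
  Over.homMk (𝟙 (Spec (CommRingCat.of F))) (by
    change 𝟙 _ ≫ 𝟙 _ = Spec.map (CommRingCat.ofHom (algebraMap F F))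
    rw [Category.comp_id]
    exact (Spec.map_id (CommRingCat.of F)).symm)

lemma specSelf_specPoint {R : Type u} [CommRing R] [Algebra F R] (e : R →ₐ[F] F) :
    specSelf ≫ specPoint e = (algSpec (CommRingCat.of F)).map (CommAlgCat.ofHom e).op := by
  ext : 1
  exact Category.id_comp (Spec.map (CommRingCat.ofHom e.toRingHom))

/-- Every morphism from an affine `F`-scheme to `Spec F` is the structure morphism. -/
lemma eq_map_specSelf (R : CommAlgCat.{u} F)
    (f : (algSpec (CommRingCat.of F)).obj (op R) ⟶ baseOver F) :
    f = (algSpec (CommRingCat.of F)).map (CommAlgCat.ofHom (Algebra.ofId F R)).op ≫ specSelf := by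
  ext : 1
  have h : ∀ g : (algSpec (CommRingCat.of F)).obj (op R) ⟶ baseOver F,
      g.left = ((algSpec (CommRingCat.of F)).obj (op R)).hom := fun g =>
    (Category.comp_id g.left).symm.trans (Over.w g)
  rw [h, h]

variable {A : Type u} [Ring A] [Algebra F A] {n : ℕ} {ρ : Multiset ℕ}

/-- The family of étale subalgebras over `Spec R` given by one étale subalgebra of `R ⊗ A`. -/
def sheafOfSubalgebra {R : Type u} [CommRing R] [Algebra F R]
    (E : (etaleSubalgebras F A n ρ).obj (CommAlgCat.of F R)) :
    (etaleSubalgebraSheaves F A n ρ).obj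
      (op ((algSpec (CommRingCat.of F)).obj (op (CommAlgCat.of F R)))) where
  app R' := ↾fun f => (etaleSubalgebras F A n ρ).map (algSpec.fullyFaithful.preimage f).unop E
  naturality R' R'' g := by
    ext f
    change (etaleSubalgebras F A n ρ).map (algSpec.fullyFaithful.preimage
        ((algSpec (CommRingCat.of F)).map g.op ≫ f)).unop E =
      (etaleSubalgebras F A n ρ).map g ((etaleSubalgebras F A n ρ).map
        (algSpec.fullyFaithful.preimage f).unop E)
    have h : algSpec.fullyFaithful.preimage ((algSpec (CommRingCat.of F)).map g.op ≫ f) =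
        g.op ≫ algSpec.fullyFaithful.preimage f :=
      algSpec.fullyFaithful.map_injective (by simp)
    rw [h, unop_comp, Functor.map_comp]
    rfl

/-- The étale subalgebra of `F ⊗ A` that corresponds to an `F`-point of the moduli functor. -/
def subalgebraOfPoint (p : (etaleSubalgebraSheaves F A n ρ).obj (op (baseOver F))) :
    (etaleSubalgebras F A n ρ).obj (CommAlgCat.of F F) :=
  p.app (CommAlgCat.of F F) specSelf

lemma subalgebraOfPoint_injective : Function.Injective (subalgebraOfPoint (A := A) (n := n) (ρ := ρ)
    (F := F)) := by
  intro p q hpq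
  refine NatTrans.ext (funext fun R => ?_)
  ext f
  have h : ∀ p : (etaleSubalgebraSheaves F A n ρ).obj (op (baseOver F)),
      p.app R f = (etaleSubalgebras F A n ρ).map (CommAlgCat.ofHom (Algebra.ofId F R))
        (subalgebraOfPoint p) := by
    intro p
    conv_lhs => rw [eq_map_specSelf R f]
    exact congrArg (fun g => g specSelf)
      (p.naturality (CommAlgCat.ofHom (Algebra.ofId F R) : CommAlgCat.of F F ⟶ R))
  exact (h p).trans ((congrArg _ hpq).trans (h q).symm)

lemma subalgebraOfPoint_map_specPoint {R : Type u} [CommRing R] [Algebra F R] (e : R →ₐ[F] F)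
    (E : (etaleSubalgebras F A n ρ).obj (CommAlgCat.of F R)) :
    subalgebraOfPoint ((etaleSubalgebraSheaves F A n ρ).map (specPoint e).op
      (sheafOfSubalgebra E)) = (etaleSubalgebras F A n ρ).map (CommAlgCat.ofHom e) E := by
  change (etaleSubalgebras F A n ρ).map (algSpec.fullyFaithful.preimage
    (specSelf ≫ specPoint e)).unop E = _
  rw [specSelf_specPoint, Functor.FullyFaithful.preimage_map]
  rfl

lemma isRTrivial_iff (G : (Over (Spec (CommRingCat.of F)))ᵒᵖ ⥤ Type*) :
    IsRTrivial G ↔ Nonempty (G.obj (op (baseOver F))) ∧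
      ∀ p q, Relation.EqvGen (ElementarilyLinked G) p q := by
  rw [IsRTrivial, Nat.card_eq_one_iff_unique, and_comm]
  refine and_congr ⟨fun ⟨x⟩ => ⟨x.out⟩, fun ⟨x⟩ => ⟨Quotient.mk _ x⟩⟩
    ⟨fun h p q => Quotient.exact (h.elim ⟦p⟧ ⟦q⟧), fun h => ⟨fun x y => ?_⟩⟩
  induction x, y using Quotient.inductionOn₂ with
  | h p q => exact Quotient.sound (h p q)

/-- R-triviality passes from a functor to every scheme that represents it. -/
lemma schemeIsRTrivial_of_representableBy {G : (Over (Spec (CommRingCat.of F)))ᵒᵖ ⥤ Type*}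
    {X : Over (Spec (CommRingCat.of F))} (r : G.RepresentableBy X) (hG : IsRTrivial G) :
    SchemeIsRTrivial X := by
  rw [SchemeIsRTrivial, isRTrivial_iff]
  obtain ⟨⟨x⟩, h⟩ := (isRTrivial_iff G).mp hG
  have key : ∀ p q : G.obj (op (baseOver F)), ElementarilyLinked G p q →
      ElementarilyLinked (yoneda.obj X) (r.homEquiv.symm p) (r.homEquiv.symm q) := by
    rintro _ _ ⟨U, hU, φ, a, b, rfl, rfl⟩
    exact ⟨U, hU, r.homEquiv.symm φ, a, b, (r.comp_homEquiv_symm φ a),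
      (r.comp_homEquiv_symm φ b)⟩
  refine ⟨⟨r.homEquiv.symm x⟩, fun p q => ?_⟩
  rw [← r.homEquiv.symm_apply_apply p, ← r.homEquiv.symm_apply_apply q]
  generalize r.homEquiv p = p', r.homEquiv q = q'
  induction h p' q' with
  | rel p q h => exact .rel _ _ (key p q h)
  | refl p => exact .refl _
  | symm p q _ ih => exact .symm _ _ ih
  | trans p q r _ _ h1 h2 => exact .trans _ _ _ h1 h2

end Points

/-! ### Base change of central simple algebras -/

section BaseChange

/-- The base change of a central simple algebra to a larger field is simple. -/
lemma isSimpleRing_baseChange (F K A : Type*) [Field F] [Field K] [Algebra F K] [Ring A]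
    [Algebra F A] [Algebra.IsCentral F A] [IsSimpleRing A] : IsSimpleRing (K ⊗[F] A) := by
  classical
  have : Nontrivial (K ⊗[F] A) := inferInstance
  refine IsSimpleRing.of_eq_bot_or_eq_top fun I => or_iff_not_imp_left.mpr fun hI => ?_
  rw [← TwoSidedIdeal.one_mem_iff]
  let b := Module.Free.chooseBasis F K
  let c := TensorProduct.equivFinsuppOfBasisLeft (N := A) b
  have hl : ∀ (a : A) x i, c ((1 ⊗ₜ a) * x) i = a * c x i := by
    intro a x i
    induction x with
    | zero => simp
    | tmul k y => simp [c, TensorProduct.equivFinsuppOfBasisLeft_apply_tmul]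
    | add x y hx hy => simp [mul_add, hx, hy]
  have hr : ∀ (a : A) x i, c (x * (1 ⊗ₜ a)) i = c x i * a := by
    intro a x i
    induction x with
    | zero => simp
    | tmul k y => simp [c, TensorProduct.equivFinsuppOfBasisLeft_apply_tmul]
    | add x y hx hy => simp [add_mul, hx, hy]
  obtain ⟨x₀, hx₀, hx₀0⟩ : ∃ x ∈ I, x ≠ 0 := by
    by_contra! h
    exact hI (TwoSidedIdeal.ext fun x => ⟨fun hx => by simpa using h x hx,
      fun hx => by rw [(TwoSidedIdeal.mem_bot _).mp hx]; exact zero_mem I⟩)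
  -- an element of `I` whose expansion in a basis of `K` has as few terms as possible
  obtain ⟨x, ⟨hxI, hx0⟩, hmin⟩ := WellFounded.has_min
    (InvImage.wf (fun x : K ⊗[F] A => (c x).support.card) wellFounded_lt)
    {x | x ∈ I ∧ x ≠ 0} ⟨x₀, hx₀, hx₀0⟩
  obtain ⟨i, hi⟩ : ∃ i, c x i ≠ 0 := by
    by_contra! h
    exact hx0 (c.injective (by ext i; simp [h i]))
  let J : TwoSidedIdeal A := TwoSidedIdeal.mk' {a | ∃ y ∈ I, (c y).support ⊆ (c x).support ∧
      c y i = a} ⟨0, zero_mem I, by simp, by simp⟩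
    (by
      rintro _ _ ⟨y, hy, hys, rfl⟩ ⟨z, hz, hzs, rfl⟩
      refine ⟨y + z, add_mem hy hz, ?_, by simp⟩
      rw [map_add]
      exact Finsupp.support_add.trans (Finset.union_subset hys hzs))
    (by
      rintro _ ⟨y, hy, hys, rfl⟩
      exact ⟨-y, neg_mem hy, by simpa using hys, by simp⟩)
    (by
      rintro a _ ⟨y, hy, hys, rfl⟩
      refine ⟨(1 ⊗ₜ a) * y, I.mul_mem_left _ _ hy, fun j hj => hys ?_, hl _ _ _⟩
      rw [Finsupp.mem_support_iff] at hj ⊢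
      exact fun h => hj (by rw [hl, h, mul_zero]))
    (by
      rintro _ a ⟨y, hy, hys, rfl⟩
      refine ⟨y * (1 ⊗ₜ a), I.mul_mem_right _ _ hy, fun j hj => hys ?_, hr _ _ _⟩
      rw [Finsupp.mem_support_iff] at hj ⊢
      exact fun h => hj (by rw [hr, h, zero_mul]))
  have hJ : (1 : A) ∈ J := IsSimpleRing.one_mem_of_ne_zero_mem J hi
    ((TwoSidedIdeal.mem_mk' ..).mpr ⟨x, hxI, subset_rfl, rfl⟩)
  obtain ⟨y, hyI, hys, hy1⟩ := (TwoSidedIdeal.mem_mk' ..).mp hJ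
  -- a commutator of `y` has fewer terms than `x`, hence vanishes
  have hcomm : ∀ a : A, (1 ⊗ₜ a) * y = y * (1 ⊗ₜ a) := by
    intro a
    by_contra hne
    refine hmin ((1 ⊗ₜ a) * y - y * (1 ⊗ₜ a)) ⟨sub_mem (I.mul_mem_left _ _ hyI)
      (I.mul_mem_right _ _ hyI), sub_ne_zero.mpr hne⟩ (Finset.card_lt_card ?_)
    refine Finset.ssubset_iff_of_subset ?_ |>.mpr ⟨i, by simpa using hi, ?_⟩
    · intro j hj
      refine hys ?_
      rw [Finsupp.mem_support_iff] at hj ⊢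
      exact fun h => hj (by simp [hl, hr, h])
    · simp [hl, hr, hy1]
  have hcen : ∀ j, ∃ f : F, algebraMap F A f = c y j := fun j => by
    have h : c y j ∈ Subalgebra.center F A := Subalgebra.mem_center_iff.mpr fun a => by
      rw [← hl, ← hr, hcomm]
    rw [Algebra.IsCentral.center_eq_bot] at h
    exact Algebra.mem_bot.mp h
  choose f hf using hcen
  let k : K := ∑ j ∈ (c y).support, f j • b j
  have hy : y = k ⊗ₜ 1 := by
    rw [← c.symm_apply_apply y, TensorProduct.equivFinsuppOfBasisLeft_symm_apply, Finsupp.sum,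
      TensorProduct.sum_tmul]
    refine Finset.sum_congr rfl fun j _ => ?_
    rw [← hf, Algebra.algebraMap_eq_smul_one, TensorProduct.tmul_smul, TensorProduct.smul_tmul']
  have hk : k ≠ 0 := by
    rintro hk
    rw [hk, TensorProduct.zero_tmul] at hy
    simp [hy] at hy1
  have h := I.mul_mem_left (k⁻¹ ⊗ₜ 1) _ hyI
  rwa [hy, Algebra.TensorProduct.tmul_mul_tmul, inv_mul_cancel₀ hk, mul_one] at h

end BaseChange

section Pullback

variable {F : Type u} [Field F] {A : Type u} [Ring A] [Algebra F A]

/-- The base change along `g : R → R'` of a linear functional on `R ⊗ A`. -/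
def pullbackFunctional {R R' : Type u} [CommRing R] [Algebra F R] [CommRing R'] [Algebra F R']
    (g : R →ₐ[F] R') (δ : R ⊗[F] A →ₗ[R] R) : R' ⊗[F] A →ₗ[R'] R' :=
  LinearMap.liftBaseChange R' (g.toLinearMap ∘ₗ δ.restrictScalars F ∘ₗ
    (Algebra.TensorProduct.includeRight : A →ₐ[F] R ⊗[F] A).toLinearMap)

lemma pullbackFunctional_map {R R' : Type u} [CommRing R] [Algebra F R] [CommRing R']
    [Algebra F R'] (g : R →ₐ[F] R') (δ : R ⊗[F] A →ₗ[R] R) (x : R ⊗[F] A) :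
    pullbackFunctional g δ (Algebra.TensorProduct.map g (AlgHom.id F A) x) = g (δ x) := by
  induction x with
  | zero => simp
  | tmul r a =>
    have h : δ (r ⊗ₜ a) = r * δ (1 ⊗ₜ a) := by
      rw [← smul_eq_mul, ← map_smul, TensorProduct.smul_tmul', smul_eq_mul, mul_one]
    simp [h, pullbackFunctional]
  | add x y hx hy => simp [hx, hy]

lemma map_smul_tensor {R R' : Type u} [CommRing R] [Algebra F R] [CommRing R']
    [Algebra F R'] (g : R →ₐ[F] R') (r : R) (x : R ⊗[F] A) :
    Algebra.TensorProduct.map g (AlgHom.id F A) (r • x) =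
      g r • Algebra.TensorProduct.map g (AlgHom.id F A) x := by
  rw [Algebra.smul_def, map_mul, Algebra.smul_def]
  simp [Algebra.TensorProduct.algebraMap_apply]

lemma pullbackSubalgebra_toSubmodule {R R' : Type u} [CommRing R] [Algebra F R] [CommRing R']
    [Algebra F R'] (g : R →ₐ[F] R') (E : Subalgebra R (R ⊗[F] A)) :
    Subalgebra.toSubmodule (pullbackSubalgebra g E) =
      Submodule.span R' (Algebra.TensorProduct.map g (AlgHom.id F A) '' (E : Set (R ⊗[F] A))) := by
  rw [pullbackSubalgebra, Algebra.adjoin_eq_span]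
  congr 1
  exact congrArg SetLike.coe <| Submonoid.closure_eq (E.toSubsemiring.toSubmonoid.map
    (Algebra.TensorProduct.map g (AlgHom.id F A)))

lemma finrank_pullbackSubalgebra {R R' : Type u} [CommRing R] [Algebra F R] [Field R']
    [Algebra F R'] (g : R →ₐ[F] R') {ι : Type*} [Fintype ι] (E : Subalgebra R (R ⊗[F] A))
    (b : Module.Basis ι R E)
    (hE : ∃ C : Submodule R (R ⊗[F] A), IsCompl (Subalgebra.toSubmodule E) C) :
    Module.finrank R' (pullbackSubalgebra g E) = Fintype.card ι := by
  classical
  obtain ⟨C, hC⟩ := hE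
  let G := Algebra.TensorProduct.map g (AlgHom.id F A)
  let δ : ι → (R ⊗[F] A →ₗ[R] R) := fun i => b.coord i ∘ₗ
    (Submodule.projectionOnto (Subalgebra.toSubmodule E) C hC : R ⊗[F] A →ₗ[R] E)
  have hδ : ∀ i j, δ i (b j) = if j = i then 1 else 0 := by
    intro i j
    have h := Submodule.projectionOnto_apply_left hC (b j)
    change b.coord i (Submodule.projectionOnto (Subalgebra.toSubmodule E) C hC (b j)) = _
    rw [h]
    simp [Finsupp.single_apply]
  have hspan : Subalgebra.toSubmodule (pullbackSubalgebra g E) =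
      Submodule.span R' (Set.range fun i => G (b i)) := by
    rw [pullbackSubalgebra_toSubmodule]
    apply le_antisymm <;> rw [Submodule.span_le]
    · rintro _ ⟨x, hx, rfl⟩
      have h := congrArg (fun z : E => G z) (b.sum_repr ⟨x, hx⟩)
      simp only [AddSubmonoidClass.coe_finsetSum, map_sum] at h
      change G x ∈ _
      rw [← h]
      refine Submodule.sum_mem _ fun i _ => ?_
      have h2 := map_smul_tensor g (b.repr ⟨x, hx⟩ i) (b i : R ⊗[F] A)
      exact h2 ▸ Submodule.smul_mem _ _ (Submodule.subset_span ⟨i, rfl⟩)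
    · rintro _ ⟨i, rfl⟩
      exact Submodule.subset_span ⟨b i, (b i).2, rfl⟩
  have hli : LinearIndependent R' fun i => G (b i) := by
    rw [Fintype.linearIndependent_iff]
    intro w hw i
    have h := congrArg (pullbackFunctional g (δ i)) hw
    simpa [G, pullbackFunctional_map, hδ] using h
  change Module.finrank R' (Subalgebra.toSubmodule (pullbackSubalgebra g E)) = _
  rw [hspan, finrank_span_eq_card hli]

end Pullback

section GeometricType

variable {Ω B : Type u} [Field Ω] [Ring B] [Algebra Ω B]

lemma CompleteOrthogonalIdempotents.linearIndependent_of_ne_zero {ι : Type*} [Fintype ι]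
    {e : ι → B} (he : CompleteOrthogonalIdempotents e) (h0 : ∀ i, e i ≠ 0) :
    LinearIndependent Ω e := by
  classical
  rw [Fintype.linearIndependent_iff]
  intro w hw i
  have h := congrArg (e i * ·) hw
  simp only [Finset.mul_sum, mul_smul_comm, mul_zero] at h
  rw [Finset.sum_eq_single i] at h
  · rw [(he.idem i).eq] at h
    exact (smul_eq_zero.mp h).resolve_right (h0 i)
  · intro j _ hj
    rw [he.ortho hj.symm, smul_zero]
  · simp

lemma HasGeometricType.finrank_eq {n : ℕ} {E : Subalgebra Ω B} {ρ : Multiset ℕ}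
    (h : HasGeometricType n E ρ) : Module.finrank Ω E = Multiset.card ρ := by
  obtain ⟨m, e, r, he, h0, hspan, -, rfl⟩ := h
  change Module.finrank Ω (Subalgebra.toSubmodule E) = _
  rw [← hspan, finrank_span_eq_card (he.linearIndependent_of_ne_zero h0)]
  simp

/-- A nonzero right ideal of a matrix algebra of degree `n` has dimension at least `n`, because it
contains all matrices with columns proportional to a fixed nonzero vector. -/
lemma le_finrank_range_mulLeft {n : ℕ} (φ : B ≃ₐ[Ω] Matrix (Fin n) (Fin n) Ω) (e : B)
    (he : e ≠ 0) : n ≤ Module.finrank Ω (LinearMap.range (LinearMap.mulLeft Ω e)) := by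
  have : Module.Finite Ω B := Module.Finite.equiv φ.symm.toLinearEquiv
  obtain ⟨u, hu⟩ : ∃ u, (φ e).mulVec u ≠ 0 := by
    by_contra! h
    refine he (φ.injective ?_)
    rw [map_zero]
    exact Matrix.ext_of_mulVec_single fun i => by rw [h, Matrix.zero_mulVec]
  have hf : ∀ w, φ.symm (Matrix.vecMulVec ((φ e).mulVec u) w) ∈
      LinearMap.range (LinearMap.mulLeft Ω e) := fun w =>
    ⟨φ.symm (Matrix.vecMulVec u w), φ.injective (by simp [Matrix.mul_vecMulVec])⟩
  let f : (Fin n → Ω) →ₗ[Ω] LinearMap.range (LinearMap.mulLeft Ω e) :=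
    (φ.symm.toLinearMap ∘ₗ _root_.vecMulVecBilin Ω Ω ((φ e).mulVec u)).codRestrict _ hf
  have hinj : Function.Injective f := by
    intro w w' h
    have h2 := φ.symm.injective (congrArg Subtype.val h)
    obtain ⟨i, hi⟩ := Function.ne_iff.mp hu
    ext j
    have h3 := congrFun (congrFun h2 i) j
    exact mul_left_cancel₀ hi h3
  simpa using LinearMap.finrank_le_finrank_of_injective hinj

/-- The dimensions of the right ideals generated by a complete system of `n` nonzero orthogonal
idempotents of a matrix algebra of degree `n` are all at least `n` and add up to `n ^ 2`. -/
lemma finrank_range_mulLeft_eq {n : ℕ} (φ : B ≃ₐ[Ω] Matrix (Fin n) (Fin n) Ω) {e : Fin n → B}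
    (he : CompleteOrthogonalIdempotents e) (h0 : ∀ i, e i ≠ 0) (i : Fin n) :
    Module.finrank Ω (LinearMap.range (LinearMap.mulLeft Ω (e i))) = n := by
  have : Module.Finite Ω B := Module.Finite.equiv φ.symm.toLinearEquiv
  let f : (∀ i, LinearMap.range (LinearMap.mulLeft Ω (e i))) →ₗ[Ω] B :=
    LinearMap.lsum Ω _ Ω fun i => Submodule.subtype _
  have hf : ∀ v j, e j * f v = v j := by
    intro v j
    simp only [f, LinearMap.lsum_apply, LinearMap.sum_apply, LinearMap.comp_apply,
      LinearMap.proj_apply, Submodule.subtype_apply, Finset.mul_sum]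
    rw [Finset.sum_eq_single j]
    · obtain ⟨x, hx⟩ := (v j).2
      rw [← hx, LinearMap.mulLeft_apply, ← mul_assoc, (he.idem j).eq]
    · intro k _ hk
      obtain ⟨x, hx⟩ := (v k).2
      rw [← hx, LinearMap.mulLeft_apply, ← mul_assoc, he.ortho hk.symm, zero_mul]
    · simp
  have hinj : Function.Injective f := fun v w h =>
    funext fun j => Subtype.ext (by rw [← hf, ← hf, h])
  have hle := LinearMap.finrank_le_finrank_of_injective hinj
  rw [Module.finrank_pi_fintype, φ.toLinearEquiv.finrank_eq, Module.finrank_matrix] at hle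
  have hge : ∀ j ∈ Finset.univ,
      n ≤ Module.finrank Ω (LinearMap.range (LinearMap.mulLeft Ω (e j))) :=
    fun j _ => le_finrank_range_mulLeft φ (e j) (h0 j)
  refine ((Finset.sum_eq_sum_iff_of_le hge).mp (le_antisymm (Finset.sum_le_sum hge) ?_) i
    (Finset.mem_univ i)).symm
  simpa using hle

/-- Over an algebraically closed field an étale algebra is split, so an étale subalgebra of rank `n`
is spanned by `n` orthogonal idempotents. -/
lemma IsEtaleSubalgebra.hasGeometricType [IsAlgClosed Ω] {n : ℕ}
    (φ : B ≃ₐ[Ω] Matrix (Fin n) (Fin n) Ω) {E : Subalgebra Ω B} (hE : IsEtaleSubalgebra E)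
    (hn : Module.finrank Ω E = n) : HasGeometricType n E (Multiset.replicate n 1) := by
  classical
  obtain ⟨-, S, _, _, _, _, ⟨ε⟩⟩ := hE
  have : IsArtinianRing S := isArtinian_of_tower Ω inferInstance
  have : Fintype (PrimeSpectrum S) := Fintype.ofFinite _
  let ψ := Algebra.FormallyEtale.equivPiOfIsSepClosed Ω S
  have hcard : Fintype.card (PrimeSpectrum S) = n := by
    rw [← hn, ← ε.toLinearEquiv.finrank_eq, ψ.toLinearEquiv.finrank_eq]
    simp
  let χ : (Fin n → Ω) →ₐ[Ω] B := E.val.comp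
    ((AlgEquiv.piCongrLeft Ω (fun _ => Ω) (Fintype.equivFinOfCardEq hcard)).symm.trans
      (ψ.symm.trans ε)).toAlgHom
  have hχ : Function.Injective χ := Subtype.val_injective.comp (AlgEquiv.injective _)
  have hrange : χ.range = E := by
    ext x
    constructor
    · rintro ⟨y, rfl⟩
      exact Subtype.property _
    · intro hx
      obtain ⟨y, hy⟩ := ((AlgEquiv.piCongrLeft Ω (fun _ => Ω)
        (Fintype.equivFinOfCardEq hcard)).symm.trans (ψ.symm.trans ε)).surjective ⟨x, hx⟩
      exact ⟨y, congrArg Subtype.val hy⟩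
  have he : CompleteOrthogonalIdempotents fun i => χ (Pi.single i 1) :=
    (CompleteOrthogonalIdempotents.single (fun _ : Fin n => Ω)).map χ.toRingHom
  have h0 : ∀ i, χ (Pi.single i 1) ≠ 0 := fun i => by
    rw [Ne, map_eq_zero_iff χ hχ]
    simp
  refine ⟨n, fun i => χ (Pi.single i 1), fun _ => 1, he, h0, ?_, fun i => ?_, by simp⟩
  · rw [← hrange]
    have h : Set.range (fun i => χ (Pi.single i (1 : Ω))) =
        χ.toLinearMap '' Set.range (fun i => Pi.single i (1 : Ω)) := by
      rw [← Set.range_comp]; rfl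
    rw [h, Submodule.span_image]
    have h2 : Submodule.span Ω (Set.range (fun i : Fin n => Pi.single i (1 : Ω))) = ⊤ := by
      have := (Pi.basisFun Ω (Fin n)).span_eq
      convert this using 3
      ext i : 1
      simp
    rw [h2, Submodule.map_top]
    rfl
  · rw [mul_one, finrank_range_mulLeft_eq φ he h0]

end GeometricType

/-! ### Families of étale subalgebras over an open subset of the line -/

section Retract

variable {R S B : Type u} [CommRing R] [CommRing S] [Algebra R S] [Ring B] [Algebra R B]

/-- The image of an étale algebra under a homomorphism with a linear retraction. -/
lemma isEtaleSubalgebra_range [Algebra.Etale R S] [Module.Finite R S] (j : S →ₐ[R] B)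
    (P : B →ₗ[R] S) (hP : ∀ s, P (j s) = s) : IsEtaleSubalgebra j.range := by
  let Q : B →ₗ[R] Subalgebra.toSubmodule j.range := j.rangeRestrict.toLinearMap ∘ₗ P
  refine ⟨⟨LinearMap.ker Q, LinearMap.isCompl_of_proj (f := Q) ?_⟩, S, inferInstance,
    inferInstance, inferInstance, inferInstance,
    ⟨AlgEquiv.ofInjective j (Function.LeftInverse.injective hP)⟩⟩
  rintro ⟨_, x, rfl⟩
  apply Subtype.ext
  change j (P (j x)) = j x
  rw [hP]

open Polynomial in
/-- `R[X] / (p)` is a standard étale algebra: the derivative of `p` is invertible in it, and no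
further localization is needed. -/
lemma etale_adjoinRoot {p : R[X]} (hp : p.Monic) (hsep : p.Separable) :
    Algebra.Etale R (AdjoinRoot p) := by
  obtain ⟨a, b, hab⟩ := hsep
  let P : StandardEtalePair R := ⟨p, hp, 1, b, a, 1, by rw [← hab]; ring⟩
  have h1 : AdjoinRoot.mk P.f P.g = 1 := map_one _
  let e : AdjoinRoot p ≃ₐ[AdjoinRoot p] Localization.Away (AdjoinRoot.mk P.f P.g) :=
    IsLocalization.atUnit _ _ (AdjoinRoot.mk P.f P.g) (by rw [h1]; exact isUnit_one)
  exact Algebra.Etale.of_equiv (P.equivAwayAdjoinRoot.trans (e.restrictScalars R).symm)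

open Polynomial in
/-- If `y` is a root of a separable monic polynomial of degree `n` and `1, y, …, y ^ (n - 1)` can be
completed to a system of coordinates, then `y` generates an étale subalgebra of rank `n`. -/
lemma isEtaleSubalgebra_adjoin_singleton {n : ℕ} {p : R[X]} (hp : p.Monic)
    (hdeg : p.natDegree = n) (hsep : p.Separable) {y : B} (hy : aeval y p = 0)
    (δ : Fin n → (B →ₗ[R] R)) (hδ : IsUnit (Matrix.of fun i j : Fin n => δ i (y ^ (j : ℕ))).det) :
    IsEtaleSubalgebra (Algebra.adjoin R {y}) ∧
      Nonempty (Module.Basis (Fin n) R (Algebra.adjoin R {y})) := by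
  subst hdeg
  have := etale_adjoinRoot hp hsep
  have := hp.finite_adjoinRoot
  let j : AdjoinRoot p →ₐ[R] B := Ideal.Quotient.liftₐ (Ideal.span {p}) (aeval y) (by
    intro a ha
    obtain ⟨c, rfl⟩ := Ideal.mem_span_singleton.mp ha
    rw [map_mul, hy, zero_mul])
  have hj : ∀ f, j (AdjoinRoot.mk p f) = aeval y f := fun f => Ideal.Quotient.liftₐ_apply _ _ _ _
  let b : Module.Basis (Fin p.natDegree) R (AdjoinRoot p) := (AdjoinRoot.powerBasis' hp).basis
  have hb : ∀ i, j (b i) = y ^ (i : ℕ) := by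
    intro i
    have h : b i = AdjoinRoot.mk p (X ^ (i : ℕ)) := by
      rw [map_pow, AdjoinRoot.mk_X]
      exact (AdjoinRoot.powerBasis' hp).basis_eq_pow i
    rw [h, hj, map_pow, aeval_X]
  have hrange : j.range = Algebra.adjoin R {y} := by
    rw [Algebra.adjoin_singleton_eq_range_aeval]
    ext x
    constructor
    · rintro ⟨z, rfl⟩
      obtain ⟨f, rfl⟩ := AdjoinRoot.mk_surjective z
      exact ⟨f, (hj f).symm⟩
    · rintro ⟨f, rfl⟩
      exact ⟨_, hj f⟩
  let M : Matrix (Fin p.natDegree) (Fin p.natDegree) R := Matrix.of fun i j => δ i (y ^ (j : ℕ))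
  let P : B →ₗ[R] AdjoinRoot p :=
    b.equivFun.symm.toLinearMap ∘ₗ (Matrix.toLin' M⁻¹) ∘ₗ LinearMap.pi δ
  have hP : ∀ s, P (j s) = s := by
    have : P ∘ₗ j.toLinearMap = LinearMap.id := b.ext fun i => by
      change b.equivFun.symm (M⁻¹.mulVec fun k => δ k (j (b i))) = b i
      have h : (fun k => δ k (j (b i))) = M.mulVec (Pi.single i 1) := by
        ext k
        rw [hb]
        simp [M]
      rw [h, Matrix.mulVec_mulVec, Matrix.nonsing_inv_mul M hδ, Matrix.one_mulVec]
      simp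
    exact fun s => LinearMap.congr_fun this s
  rw [← hrange]
  exact ⟨isEtaleSubalgebra_range j P hP,
    ⟨b.map (AlgEquiv.ofInjective j (Function.LeftInverse.injective hP)).toLinearEquiv⟩⟩

end Retract

section Link

variable {F : Type u} [Field F] {A : Type u} [Ring A] [Algebra F A]

/-- Two subalgebras of `A` are linked by a family of étale subalgebras of rank `n` over an open
subset of the affine line if they are the members of the family at `0` and `1`. -/
def SubalgebraLinked (n : ℕ) (E₀ E₁ : Subalgebra F (F ⊗[F] A)) : Prop :=
  ∃ (h : Polynomial F) (h0 : h.eval 0 ≠ 0) (h1 : h.eval 1 ≠ 0)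
    (E : Subalgebra (Localization.Away h) (Localization.Away h ⊗[F] A)),
    IsEtaleSubalgebra E ∧ Nonempty (Module.Basis (Fin n) (Localization.Away h) E) ∧
    pullbackSubalgebra (evalAway h 0 h0) E = E₀ ∧ pullbackSubalgebra (evalAway h 1 h1) E = E₁

lemma exists_algEquiv_matrix_baseChange [Algebra.IsCentral F A] [IsSimpleRing A]
    [FiniteDimensional F A] {n : ℕ} (hn : Module.finrank F A = n ^ 2) (K : Type u) [Field K]
    [IsAlgClosed K] [Algebra F K] : Nonempty (K ⊗[F] A ≃ₐ[K] Matrix (Fin n) (Fin n) K) := by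
  have := isSimpleRing_baseChange F K A
  obtain ⟨m, _, ⟨φ⟩⟩ := IsSimpleRing.exists_algEquiv_matrix_of_isAlgClosed K (K ⊗[F] A)
  have h := φ.toLinearEquiv.finrank_eq
  rw [Module.finrank_baseChange, hn, Module.finrank_matrix] at h
  have : n = m := by simpa [← pow_two] using h
  exact ⟨this ▸ φ⟩

lemma degree_pos [Nontrivial A] [FiniteDimensional F A] {n : ℕ}
    (hn : Module.finrank F A = n ^ 2) : 0 < n := by
  have : 0 < Module.finrank F A := Module.finrank_pos
  rw [hn] at this
  exact Nat.pos_of_ne_zero fun h => by simp [h] at this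

lemma finrank_subalgebraOfPoint [FiniteDimensional F A] {n : ℕ}
    (p : (et F A n n).obj (op (baseOver F))) :
    Module.finrank F (subalgebraOfPoint p).1 = n := by
  let Ω := AlgebraicClosure F
  have h := ((subalgebraOfPoint p).2.2 Ω (Algebra.ofId F Ω)).finrank_eq
  have b := Module.Free.chooseBasis F (Subalgebra.toSubmodule (subalgebraOfPoint p).1)
  have h2 := finrank_pullbackSubalgebra (Algebra.ofId F Ω) (subalgebraOfPoint p).1 b
    (subalgebraOfPoint p).2.1.1
  exact (Module.finrank_eq_card_basis b).trans
    (h2.symm.trans (h.trans (Multiset.card_replicate _ _)))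

variable [Algebra.IsCentral F A] [IsSimpleRing A] [FiniteDimensional F A] {n : ℕ}

/-- An étale subalgebra of rank `n = deg A` has type `[1, …, 1]`. -/
def etaleSubalgebraOfBasis (hn : Module.finrank F A = n ^ 2) {R : Type u} [CommRing R]
    [Algebra F R] (E : Subalgebra R (R ⊗[F] A)) (hE : IsEtaleSubalgebra E)
    (b : Nonempty (Module.Basis (Fin n) R E)) :
    (etaleSubalgebras F A n (Multiset.replicate n (n / n))).obj (CommAlgCat.of F R) :=
  ⟨E, hE, fun Ω _ _ _ x => by
    obtain ⟨φ⟩ := exists_algEquiv_matrix_baseChange hn Ω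
    rw [Nat.div_self (degree_pos hn)]
    refine (hE.pullback x).hasGeometricType φ ?_
    rw [finrank_pullbackSubalgebra x E b.some hE.1, Fintype.card_fin]⟩

lemma elementarilyLinked_of_subalgebraLinked (hn : Module.finrank F A = n ^ 2)
    (p q : (et F A n n).obj (op (baseOver F)))
    (hpq : SubalgebraLinked n (subalgebraOfPoint p).1 (subalgebraOfPoint q).1) :
    ElementarilyLinked (et F A n n) p q := by
  obtain ⟨h, h0, h1, E, hE, b, hp, hq⟩ := hpq
  have := elementarilyLinked_specPoint (et F A n n) h
    (sheafOfSubalgebra (etaleSubalgebraOfBasis hn E hE b)) 0 1 h0 h1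
  convert this
  · exact subalgebraOfPoint_injective ((Subtype.ext hp.symm).trans
      (subalgebraOfPoint_map_specPoint _ (etaleSubalgebraOfBasis hn E hE b)).symm)
  · exact subalgebraOfPoint_injective ((Subtype.ext hq.symm).trans
      (subalgebraOfPoint_map_specPoint _ (etaleSubalgebraOfBasis hn E hE b)).symm)

/-- Every étale subalgebra of rank `n` is a point of the moduli functor. -/
lemma exists_subalgebraOfPoint_eq (hn : Module.finrank F A = n ^ 2) {E : Subalgebra F (F ⊗[F] A)}
    (hE : IsEtaleSubalgebra E) (hr : Module.finrank F E = n) :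
    ∃ p : (et F A n n).obj (op (baseOver F)), (subalgebraOfPoint p).1 = E := by
  have : Module.Free F E := Module.Free.of_divisionRing F E
  let ε := etaleSubalgebraOfBasis hn E hE ⟨Module.finBasisOfFinrankEq F E hr⟩
  refine ⟨(et F A n n).map (specPoint (AlgHom.id F F)).op (sheafOfSubalgebra ε), ?_⟩
  exact (congrArg Subtype.val (subalgebraOfPoint_map_specPoint (AlgHom.id F F) ε)).trans
    (pullbackSubalgebra_id E)

/-- The moduli functor is R-trivial if the étale subalgebras of rank `n` exist and are all
connected by chains of families over open subsets of the affine line. -/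
lemma isRTrivial_et (hn : Module.finrank F A = n ^ 2)
    (hex : ∃ E : Subalgebra F (F ⊗[F] A), IsEtaleSubalgebra E ∧ Module.finrank F E = n)
    (hlink : ∀ E₀ E₁ : Subalgebra F (F ⊗[F] A), IsEtaleSubalgebra E₀ → Module.finrank F E₀ = n →
      IsEtaleSubalgebra E₁ → Module.finrank F E₁ = n →
      Relation.EqvGen (SubalgebraLinked n) E₀ E₁) :
    IsRTrivial (et F A n n) := by
  rw [isRTrivial_iff]
  obtain ⟨E, hE, hr⟩ := hex
  obtain ⟨p₀, -⟩ := exists_subalgebraOfPoint_eq hn hE hr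
  refine ⟨⟨p₀⟩, fun p q => ?_⟩
  let good : Subalgebra F (F ⊗[F] A) → Prop := fun E => IsEtaleSubalgebra E ∧ Module.finrank F E = n
  have key : ∀ E₀ E₁, Relation.EqvGen (SubalgebraLinked (F := F) (A := A) n) E₀ E₁ →
      (good E₀ ↔ good E₁) ∧ ∀ p q : (et F A n n).obj (op (baseOver F)),
        (subalgebraOfPoint p).1 = E₀ → (subalgebraOfPoint q).1 = E₁ →
        Relation.EqvGen (ElementarilyLinked (et F A n n)) p q := by
    intro E₀ E₁ h
    induction h with
    | rel E₀ E₁ h =>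
      refine ⟨?_, fun p q hp hq => .rel _ _ (elementarilyLinked_of_subalgebraLinked hn p q
        (by rwa [hp, hq]))⟩
      obtain ⟨h, h0, h1, E, hE, ⟨b⟩, rfl, rfl⟩ := h
      have hg : ∀ g : Localization.Away h →ₐ[F] F, good (pullbackSubalgebra g E) := fun g =>
        ⟨hE.pullback g, by rw [finrank_pullbackSubalgebra g E b hE.1, Fintype.card_fin]⟩
      exact iff_of_true (hg _) (hg _)
    | refl E =>
      refine ⟨Iff.rfl, fun p q hp hq => ?_⟩
      obtain rfl : p = q := subalgebraOfPoint_injective (Subtype.ext (hp.trans hq.symm))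
      exact .refl _
    | symm E₀ E₁ _ ih => exact ⟨ih.1.symm, fun p q hp hq => .symm _ _ (ih.2 q p hq hp)⟩
    | trans E₀ E₁ E₂ _ _ h1 h2 =>
      refine ⟨h1.1.trans h2.1, fun p q hp hq => ?_⟩
      obtain ⟨hE, hr⟩ := h1.1.mp ⟨hp ▸ (subalgebraOfPoint p).2.1,
        hp ▸ finrank_subalgebraOfPoint p⟩
      obtain ⟨x, hx⟩ := exists_subalgebraOfPoint_eq hn hE hr
      exact .trans _ _ _ (h1.2 p x hp hx) (h2.2 x q hx hq)
  exact (key _ _ (hlink _ _ (subalgebraOfPoint p).2.1 (finrank_subalgebraOfPoint p)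
    (subalgebraOfPoint q).2.1 (finrank_subalgebraOfPoint q))).2 p q rfl rfl

end Link

/-! ### Lines in a central simple algebra -/

section Generator

open Polynomial

variable {F : Type u} [Field F] {A : Type u} [Ring A] [Algebra F A]

lemma map_aeval_tensor {R R' : Type u} [CommRing R] [Algebra F R] [CommRing R'] [Algebra F R']
    (g : R →ₐ[F] R') (x : R ⊗[F] A) (f : R[X]) :
    Algebra.TensorProduct.map g (AlgHom.id F A) (aeval x f) =
      aeval (Algebra.TensorProduct.map g (AlgHom.id F A) x) (f.map g.toRingHom) := by
  refine map_aeval_eq_aeval_map (ψ := (Algebra.TensorProduct.map g (AlgHom.id F A)).toRingHom)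
    (RingHom.ext fun r => ?_) f x
  simp [Algebra.TensorProduct.algebraMap_apply]

lemma pullbackSubalgebra_adjoin {R R' : Type u} [CommRing R] [Algebra F R] [CommRing R']
    [Algebra F R'] (g : R →ₐ[F] R') (x : R ⊗[F] A) :
    pullbackSubalgebra g (Algebra.adjoin R {x}) =
      Algebra.adjoin R' {Algebra.TensorProduct.map g (AlgHom.id F A) x} := by
  apply le_antisymm
  · refine Algebra.adjoin_le ?_
    rintro _ ⟨y, hy, rfl⟩
    rw [Algebra.adjoin_singleton_eq_range_aeval] at hy
    obtain ⟨f, rfl⟩ := hy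
    change Algebra.TensorProduct.map g (AlgHom.id F A) (aeval x f) ∈ _
    rw [map_aeval_tensor, Algebra.adjoin_singleton_eq_range_aeval]
    exact ⟨_, rfl⟩
  · rw [Algebra.adjoin_le_iff, Set.singleton_subset_iff]
    exact Algebra.subset_adjoin ⟨x, Algebra.self_mem_adjoin_singleton R x, rfl⟩

/-- The functionals dual to the powers `1, x, …, x ^ (n - 1)`, where `n` is at most the degree of
the minimal polynomial of `x`. -/
lemma exists_dual_pow {n : ℕ} {x : F ⊗[F] A} (hx : n ≤ (minpoly F x).natDegree) :
    ∃ δ : Fin n → (F ⊗[F] A →ₗ[F] F),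
      ∀ i j : Fin n, δ i (x ^ (j : ℕ)) = if i = j then 1 else 0 := by
  have hli : LinearIndependent F fun i : Fin n => x ^ (i : ℕ) :=
    (linearIndependent_pow x).comp (Fin.castLE hx) (Fin.castLE_injective hx)
  obtain ⟨L, hL⟩ := LinearMap.exists_leftInverse_of_injective
    (Fintype.linearCombination F fun i : Fin n => x ^ (i : ℕ))
    (LinearMap.ker_eq_bot.mpr hli.fintypeLinearCombination_injective)
  refine ⟨fun i => LinearMap.proj i ∘ₗ L, fun i j => ?_⟩
  have h := LinearMap.congr_fun hL (Pi.single j 1)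
  simp only [LinearMap.comp_apply, Fintype.linearCombination_apply_single, one_smul,
    LinearMap.id_apply] at h
  simp [h, Pi.single_apply]

lemma resultant_derivative_ne_zero {F : Type*} [Field F] {f : F[X]} (hf : f.Monic)
    (hsep : f.Separable) :
    resultant f (derivative f) f.natDegree f.natDegree ≠ 0 := by
  obtain ⟨k, hk⟩ := Nat.exists_eq_add_of_le (natDegree_derivative_le f |>.trans (Nat.sub_le _ _))
  have h := resultant_add_right_deg (f := f) (g := derivative f) (m := f.natDegree)
    (n := (derivative f).natDegree) k le_rfl
  rw [← hk, coeff_natDegree, hf.leadingCoeff, one_pow, one_mul] at h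
  rw [h, Ne, resultant_eq_zero_iff]
  exact fun h => h.2 hsep

lemma Polynomial.Monic.separable_of_isUnit_resultant {R : Type*} [CommRing R] {p : R[X]}
    (hp : p.Monic)
    (h : IsUnit (resultant p (derivative p) p.natDegree p.natDegree)) : p.Separable := by
  rcases Nat.eq_zero_or_pos p.natDegree with h0 | hpos
  · rw [hp.natDegree_eq_zero.mp h0]
    exact separable_one
  obtain ⟨a, b, -, -, hab⟩ := exists_mul_add_mul_eq_C_resultant p (derivative p) le_rfl
    ((natDegree_derivative_le _).trans (Nat.sub_le _ _)) (Or.inl hpos.ne')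
  obtain ⟨u, hu⟩ := h
  rw [← hu] at hab
  have hu1 : C (↑u⁻¹ : R) * C (u : R) = 1 := by rw [← C_mul, Units.inv_mul, C_1]
  refine ⟨C (↑u⁻¹ : R) * a, C (↑u⁻¹ : R) * b, ?_⟩
  rw [← hu1, ← hab]
  ring

/-- In a central simple algebra of degree `n`, `n` functionals with nonvanishing Gram determinant on
`1, x, …, x ^ (n - 1)` express a multiple of `x ^ n` by lower powers, by Cramer's rule. -/
lemma aeval_cramer_eq_zero [Algebra.IsCentral F A] [IsSimpleRing A] [FiniteDimensional F A] {n : ℕ}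
    (hn : Module.finrank F A = n ^ 2) {T : Type u} [CommRing T] [IsDomain T] [Algebra F T]
    (x : T ⊗[F] A) (δ : Fin n → (T ⊗[F] A →ₗ[T] T)) (M : Matrix (Fin n) (Fin n) T)
    (hM : ∀ i j, M i j = δ i (x ^ (j : ℕ))) :
    M.det • x ^ n - ∑ i, (M.adjugate.mulVec fun k => δ k (x ^ n)) i • x ^ (i : ℕ) = 0 := by
  let K := AlgebraicClosure (FractionRing T)
  let g : T →ₐ[F] K := IsScalarTower.toAlgHom F T K
  have hg : Function.Injective g := by
    change Function.Injective (algebraMap T K)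
    rw [IsScalarTower.algebraMap_eq T (FractionRing T) K]
    exact (algebraMap (FractionRing T) K).injective.comp (IsFractionRing.injective T _)
  let G := Algebra.TensorProduct.map g (AlgHom.id F A)
  have hG : Function.Injective G := Module.Flat.rTensor_preserves_injective_linearMap (M := A)
    g.toLinearMap hg
  obtain ⟨φ⟩ := exists_algEquiv_matrix_baseChange hn K
  let q := (φ (G x)).charpoly
  have hq : ∑ i : Fin n, q.coeff i • G x ^ (i : ℕ) + G x ^ n = 0 := by
    have h : aeval (G x) q = 0 := φ.injective (by
      rw [map_zero, ← aeval_algHom_apply]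
      exact Matrix.aeval_self_charpoly _)
    have hd : q.natDegree = n := by simp [q, Matrix.charpoly_natDegree_eq_dim]
    have hc : q.coeff n = 1 := by
      rw [← hd]
      exact (Matrix.charpoly_monic (φ (G x))).coeff_natDegree
    rw [aeval_eq_sum_range, hd, Finset.sum_range_succ, hc, one_smul] at h
    rw [← h, Fin.sum_univ_eq_sum_range (fun i => q.coeff i • G x ^ i)]
  have hv : (fun k => g (δ k (x ^ n))) = -(M.map g).mulVec fun i : Fin n => q.coeff i := by
    ext k
    have h := congrArg (pullbackFunctional g (δ k)) hq
    simp only [map_add, map_sum, map_smul, map_zero, ← map_pow, G, pullbackFunctional_map] at h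
    rw [Pi.neg_apply, eq_neg_iff_add_eq_zero, add_comm, ← h]
    congr 1
    simp [Matrix.mulVec, dotProduct, hM, mul_comm]
  have hc : ∀ i, g ((M.adjugate.mulVec fun k => δ k (x ^ n)) i) = -(g M.det * q.coeff i) := by
    intro i
    have h : (fun i => g ((M.adjugate.mulVec fun k => δ k (x ^ n)) i)) =
        (M.adjugate.map g).mulVec fun k => g (δ k (x ^ n)) :=
      funext fun i => RingHom.map_mulVec g.toRingHom M.adjugate _ i
    have h2 : M.adjugate.map g * M.map g = g M.det • (1 : Matrix (Fin n) (Fin n) K) := by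
      rw [← Matrix.map_mul, Matrix.adjugate_mul]
      ext i j
      by_cases hij : i = j <;> simp [hij]
    have h3 : (M.adjugate.map g).mulVec ((M.map g).mulVec fun i : Fin n => q.coeff i) =
        g M.det • fun i : Fin n => q.coeff i := by
      rw [Matrix.mulVec_mulVec, h2, Matrix.smul_mulVec, Matrix.one_mulVec]
    have h4 := congrFun h i
    rw [hv, Matrix.mulVec_neg, h3] at h4
    simpa using h4
  refine hG ?_
  rw [map_zero, map_sub, map_sum]
  simp only [G, map_smul_tensor, hc]
  rw [← smul_zero (g M.det), ← hq, smul_add, Finset.smul_sum]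
  simp only [map_pow, neg_smul, mul_smul, Finset.sum_neg_distrib, sub_neg_eq_add, G]
  rw [add_comm]

/-- For a family `x` of elements of `A` over `T` and functionals `δ`, the polynomial over `T` with
root `x` given by Cramer's rule. -/
def cramerPoly {n : ℕ} {T : Type u} [CommRing T] [Algebra F T] (x : T ⊗[F] A)
    (δ : Fin n → (T ⊗[F] A →ₗ[T] T)) : T[X] :=
  let M : Matrix (Fin n) (Fin n) T := Matrix.of fun i j => δ i (x ^ (j : ℕ))
  C M.det * X ^ n - ∑ i : Fin n, C ((M.adjugate.mulVec fun k => δ k (x ^ n)) i) * X ^ (i : ℕ)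

lemma aeval_cramerPoly [Algebra.IsCentral F A] [IsSimpleRing A] [FiniteDimensional F A] {n : ℕ}
    (hn : Module.finrank F A = n ^ 2) {T : Type u} [CommRing T] [IsDomain T] [Algebra F T]
    (x : T ⊗[F] A) (δ : Fin n → (T ⊗[F] A →ₗ[T] T)) : aeval x (cramerPoly x δ) = 0 := by
  rw [cramerPoly, ← aeval_cramer_eq_zero hn x δ (Matrix.of fun i j => δ i (x ^ (j : ℕ)))
    fun _ _ => rfl]
  simp only [map_sub, map_sum, map_mul, aeval_C, aeval_X, map_pow, Algebra.smul_def]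

lemma natDegree_cramerPoly_le {n : ℕ} {T : Type u} [CommRing T] [Algebra F T] (x : T ⊗[F] A)
    (δ : Fin n → (T ⊗[F] A →ₗ[T] T)) : (cramerPoly x δ).natDegree ≤ n :=
  (natDegree_sub_le_of_le (natDegree_C_mul_X_pow_le _ _) (natDegree_le_of_degree_le
    (degree_sum_fin_lt _).le)).trans (max_self n).le

lemma coeff_cramerPoly {n : ℕ} {T : Type u} [CommRing T] [Algebra F T] (x : T ⊗[F] A)
    (δ : Fin n → (T ⊗[F] A →ₗ[T] T)) : (cramerPoly x δ).coeff n =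
      (Matrix.of fun i j : Fin n => δ i (x ^ (j : ℕ))).det := by
  rw [cramerPoly, coeff_sub, coeff_C_mul_X_pow, if_pos rfl,
    coeff_eq_zero_of_degree_lt (degree_sum_fin_lt _), sub_zero]

/-- If `x` specializes to an element whose minimal polynomial is separable of degree `n`, and `δ` to
the functionals dual to its powers, then the polynomial `cramerPoly x δ` specializes to the minimal
polynomial, so that neither its leading coefficient nor its discriminant vanishes. -/
lemma cramerPoly_specialize [Algebra.IsCentral F A] [IsSimpleRing A] [FiniteDimensional F A] {n : ℕ}
    (hn : Module.finrank F A = n ^ 2) {T : Type u} [CommRing T] [IsDomain T] [Algebra F T]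
    (x : T ⊗[F] A) (δ : Fin n → (T ⊗[F] A →ₗ[T] T)) (ev : T →ₐ[F] F) {x₀ : F ⊗[F] A}
    (hx : Algebra.TensorProduct.map ev (AlgHom.id F A) x = x₀)
    (hdeg : (minpoly F x₀).natDegree = n) (hsep : (minpoly F x₀).Separable)
    (δ₀ : Fin n → (F ⊗[F] A →ₗ[F] F))
    (hδ₀ : ∀ i j : Fin n, δ₀ i (x₀ ^ (j : ℕ)) = if i = j then 1 else 0)
    (hδ : ∀ i z, ev (δ i z) = δ₀ i (Algebra.TensorProduct.map ev (AlgHom.id F A) z)) :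
    ev ((Matrix.of fun i j : Fin n => δ i (x ^ (j : ℕ))).det) = 1 ∧
      ev (resultant (cramerPoly x δ) (derivative (cramerPoly x δ)) n n) ≠ 0 := by
  have hm : ev ((Matrix.of fun i j : Fin n => δ i (x ^ (j : ℕ))).det) = 1 := by
    rw [AlgHom.map_det]
    convert Matrix.det_one (n := Fin n)
    ext i j
    simp [hδ, hx, hδ₀, Matrix.one_apply]
  refine ⟨hm, ?_⟩
  have hint : IsIntegral F x₀ := Algebra.IsIntegral.isIntegral x₀
  let P₀ := (cramerPoly x δ).map ev.toRingHom
  have hle : P₀.natDegree ≤ n := natDegree_map_le.trans (natDegree_cramerPoly_le x δ)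
  have hcoeff : P₀.coeff n = 1 := by
    rw [coeff_map, coeff_cramerPoly]
    exact hm
  have hP₀ : minpoly F x₀ = P₀ := by
    refine (eq_of_monic_of_dvd_of_natDegree_le (minpoly.monic hint)
      (monic_of_natDegree_le_of_coeff_eq_one n hle hcoeff) (minpoly.dvd F x₀ ?_)
      (by rwa [hdeg])).symm
    rw [← hx, ← map_aeval_tensor, aeval_cramerPoly hn, map_zero]
  have h := resultant_derivative_ne_zero (minpoly.monic hint) hsep
  rw [hdeg, hP₀, derivative_map] at h
  intro h2
  refine h ((resultant_map_map ..).trans ?_)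
  exact h2

/-- Where neither the leading coefficient nor the discriminant of `cramerPoly x δ` vanishes, the
family `x` generates a family of étale subalgebras. -/
lemma isEtaleSubalgebra_adjoin_family [Algebra.IsCentral F A] [IsSimpleRing A]
    [FiniteDimensional F A] {n : ℕ} (hn : Module.finrank F A = n ^ 2) {T R : Type u} [CommRing T]
    [IsDomain T] [Algebra F T] [CommRing R] [Nontrivial R] [Algebra F R]
    (g : T →ₐ[F] R) (x : T ⊗[F] A) (δ : Fin n → (T ⊗[F] A →ₗ[T] T))
    (hm : IsUnit (g (Matrix.of fun i j : Fin n => δ i (x ^ (j : ℕ))).det))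
    (hr : IsUnit (g (resultant (cramerPoly x δ) (derivative (cramerPoly x δ)) n n))) :
    IsEtaleSubalgebra (Algebra.adjoin R {Algebra.TensorProduct.map g (AlgHom.id F A) x}) ∧
      Nonempty (Module.Basis (Fin n) R
        (Algebra.adjoin R {Algebra.TensorProduct.map g (AlgHom.id F A) x})) := by
  obtain ⟨u, hu⟩ := hm
  obtain ⟨v, hv⟩ := hr
  let p : R[X] := C (↑u⁻¹ : R) * (cramerPoly x δ).map g.toRingHom
  have hle : p.natDegree ≤ n :=
    (natDegree_C_mul_le _ _).trans (natDegree_map_le.trans (natDegree_cramerPoly_le x δ))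
  have hcoeff : p.coeff n = 1 := by
    rw [coeff_C_mul, coeff_map, coeff_cramerPoly]
    exact (congrArg _ hu.symm).trans u.inv_mul
  have hdeg : p.natDegree = n := natDegree_eq_of_le_of_coeff_ne_zero hle
    (by rw [hcoeff]; exact one_ne_zero)
  refine isEtaleSubalgebra_adjoin_singleton (p := p)
    (monic_of_natDegree_le_of_coeff_eq_one n hle hcoeff) hdeg ?_ ?_
    (fun i => pullbackFunctional g (δ i)) ?_
  · obtain ⟨a, b, -, -, hab⟩ := exists_mul_add_mul_eq_C_resultant (cramerPoly x δ)
      (derivative (cramerPoly x δ)) (natDegree_cramerPoly_le x δ)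
      ((natDegree_derivative_le _).trans ((Nat.sub_le _ _).trans (natDegree_cramerPoly_le x δ)))
      (Or.inl (degree_pos hn).ne')
    have h := congrArg (Polynomial.map g.toRingHom) hab
    rw [Polynomial.map_add, Polynomial.map_mul, Polynomial.map_mul, map_C, ← derivative_map] at h
    have hv' : (C (g.toRingHom (resultant (cramerPoly x δ) (derivative (cramerPoly x δ)) n n))) =
      C (v : R) := congrArg C hv.symm
    rw [hv'] at h
    have hp : (cramerPoly x δ).map g.toRingHom = C (u : R) * p := by
      rw [← mul_assoc, ← C_mul, Units.mul_inv, C_1, one_mul]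
    rw [hp, derivative_C_mul] at h
    have hvv : C (↑v⁻¹ : R) * C (v : R) = 1 := by rw [← C_mul, Units.inv_mul, C_1]
    refine ⟨C (↑v⁻¹ : R) * C (u : R) * a.map g.toRingHom,
      C (↑v⁻¹ : R) * C (u : R) * b.map g.toRingHom, ?_⟩
    rw [← hvv, ← h]
    ring
  · rw [map_mul, ← map_aeval_tensor, aeval_cramerPoly hn, map_zero, mul_zero]
  · simp only [← map_pow, pullbackFunctional_map]
    rw [AlgHom.map_det] at hu
    exact ⟨u, hu⟩

lemma apply_pullbackFunctional_ofId {T : Type u} [CommRing T] [Algebra F T] (ev : T →ₐ[F] F)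
    (δ : F ⊗[F] A →ₗ[F] F) (z : T ⊗[F] A) :
    ev (pullbackFunctional (Algebra.ofId F T) δ z) =
      δ (Algebra.TensorProduct.map ev (AlgHom.id F A) z) := by
  induction z with
  | zero => simp
  | tmul t a =>
    have h : δ (ev t ⊗ₜ a) = ev t * δ (1 ⊗ₜ a) := by
      rw [← smul_eq_mul, ← map_smul, TensorProduct.smul_tmul', smul_eq_mul, mul_one]
    simp [pullbackFunctional, h]
  | add x y hx hy => simp [hx, hy]

/-- The line through two generators of étale subalgebras of rank `n` links these subalgebras. -/
lemma subalgebraLinked_adjoin [Algebra.IsCentral F A] [IsSimpleRing A] [FiniteDimensional F A]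
    {n : ℕ} (hn : Module.finrank F A = n ^ 2) {x₀ x₁ : F ⊗[F] A}
    (hdeg₀ : (minpoly F x₀).natDegree = n) (hsep₀ : (minpoly F x₀).Separable)
    (hdeg₁ : (minpoly F x₁).natDegree = n) (hsep₁ : (minpoly F x₁).Separable) :
    SubalgebraLinked n (Algebra.adjoin F {x₀}) (Algebra.adjoin F {x₁}) := by
  obtain ⟨δ₀, hδ₀⟩ := exists_dual_pow hdeg₀.ge
  obtain ⟨δ₁, hδ₁⟩ := exists_dual_pow hdeg₁.ge
  let ι := Algebra.TensorProduct.map (Algebra.ofId F F[X]) (AlgHom.id F A)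
  let x : F[X] ⊗[F] A := (1 - X : F[X]) • ι x₀ + (X : F[X]) • ι x₁
  let δ : Fin n → (F[X] ⊗[F] A →ₗ[F[X]] F[X]) := fun i =>
    (1 - X : F[X]) • pullbackFunctional (Algebra.ofId F F[X]) (δ₀ i) +
      (X : F[X]) • pullbackFunctional (Algebra.ofId F F[X]) (δ₁ i)
  have hι : ∀ (s : F) (z : F ⊗[F] A),
      Algebra.TensorProduct.map (aeval s : F[X] →ₐ[F] F) (AlgHom.id F A) (ι z) = z := by
    intro s z
    induction z with
    | zero => simp
    | tmul c a => simp [ι, Algebra.ofId_apply]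
    | add x y hx hy => rw [map_add, map_add, hx, hy]
  have hx : ∀ s : F, Algebra.TensorProduct.map (aeval s : F[X] →ₐ[F] F) (AlgHom.id F A) x =
      (1 - s) • x₀ + s • x₁ := by
    intro s
    simp only [x, map_add, map_smul_tensor, hι, map_sub, map_one, aeval_X]
  have hδ : ∀ (s : F) i z, (aeval s : F[X] →ₐ[F] F) (δ i z) =
      (1 - s) * δ₀ i (Algebra.TensorProduct.map (aeval s : F[X] →ₐ[F] F) (AlgHom.id F A) z) +
      s * δ₁ i (Algebra.TensorProduct.map (aeval s : F[X] →ₐ[F] F) (AlgHom.id F A) z) := by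
    intro s i z
    simp only [δ, LinearMap.add_apply, LinearMap.smul_apply, smul_eq_mul, map_add, map_mul,
      apply_pullbackFunctional_ofId, map_sub, map_one, aeval_X]
  obtain ⟨hm₀, hr₀⟩ := cramerPoly_specialize hn x δ (aeval 0) (by simp [hx]) hdeg₀ hsep₀ δ₀ hδ₀
    (by simp [hδ])
  obtain ⟨hm₁, hr₁⟩ := cramerPoly_specialize hn x δ (aeval 1) (by simp [hx]) hdeg₁ hsep₁ δ₁ hδ₁
    (by simp [hδ])
  set m := (Matrix.of fun i j : Fin n => δ i (x ^ (j : ℕ))).det with hm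
  set r := resultant (cramerPoly x δ) (derivative (cramerPoly x δ)) n n with hr
  have h0 : (m * r).eval 0 ≠ 0 := by
    rw [← coe_aeval_eq_eval, map_mul, hm₀, one_mul]
    exact hr₀
  have h1 : (m * r).eval 1 ≠ 0 := by
    rw [← coe_aeval_eq_eval, map_mul, hm₁, one_mul]
    exact hr₁
  let g : F[X] →ₐ[F] Localization.Away (m * r) := IsScalarTower.toAlgHom F F[X] _
  have hu : IsUnit (g m * g r) := by
    rw [← map_mul]
    exact IsLocalization.Away.algebraMap_isUnit (m * r)
  have : Nontrivial (Localization.Away (m * r)) :=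
    (evalAway (m * r) 0 h0).toRingHom.domain_nontrivial
  obtain ⟨hE, hb⟩ := isEtaleSubalgebra_adjoin_family hn g x δ (isUnit_of_mul_isUnit_left hu)
    (isUnit_of_mul_isUnit_right hu)
  have hev : ∀ (s : F) (hs : (m * r).eval s ≠ 0),
      pullbackSubalgebra (evalAway (m * r) s hs)
        (Algebra.adjoin _ {Algebra.TensorProduct.map g (AlgHom.id F A) x}) =
      Algebra.adjoin F {(1 - s) • x₀ + s • x₁} := by
    intro s hs
    rw [← pullbackSubalgebra_adjoin, ← pullbackSubalgebra_comp, pullbackSubalgebra_adjoin]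
    have : (evalAway (m * r) s hs).comp g = aeval s := by
      ext
      simp [g, evalAway_algebraMap]
    rw [this, hx]
  exact ⟨m * r, h0, h1, _, hE, hb, by simp [hev], by simp [hev]⟩

end Generator

/-! ### Infinite base fields -/

section Infinite

open Polynomial

/-- A polynomial of degree at most `n` with `n` distinct roots has degree `n` and is separable. -/
lemma separable_of_injective_roots {F K : Type*} [Field F] [Field K] [Algebra F K] {n : ℕ}
    {f : F[X]} (hf : f.Monic) (hle : f.natDegree ≤ n) {r : Fin n → K} (hr : Function.Injective r)
    (hroot : ∀ i, aeval (r i) f = 0) : f.natDegree = n ∧ f.Separable := by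
  have hdvd : ∏ i, (X - C (r i)) ∣ f.map (algebraMap F K) :=
    Finset.prod_dvd_of_coprime (fun i _ j _ hij => pairwise_coprime_X_sub_C hr hij) fun i _ => by
      rw [dvd_iff_isRoot, IsRoot, eval_map_algebraMap, hroot]
  have hmonic : (∏ i, (X - C (r i))).Monic := monic_prod_X_sub_C _ _
  have hdeg : (∏ i, (X - C (r i))).natDegree = n := by
    rw [natDegree_prod_of_monic _ _ fun i _ => monic_X_sub_C _]
    simp
  have heq : f.map (algebraMap F K) = ∏ i, (X - C (r i)) :=
    eq_of_monic_of_dvd_of_natDegree_le hmonic (hf.map _) hdvd (by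
      rw [hdeg, natDegree_map]; exact hle)
  refine ⟨by rw [← natDegree_map (algebraMap F K), heq, hdeg], ?_⟩
  rw [← separable_map (algebraMap F K), heq]
  exact separable_prod_X_sub_C_iff.mpr hr

variable {F : Type u} [Field F]

/-- An étale algebra over an infinite field is generated by one element. -/
lemma exists_separable_minpoly [Infinite F] {S : Type u} [CommRing S] [Algebra F S]
    [Algebra.Etale F S] [Module.Finite F S] :
    ∃ θ : S, (minpoly F θ).natDegree = Module.finrank F S ∧ (minpoly F θ).Separable := by
  let K := AlgebraicClosure F
  have : IsArtinianRing (K ⊗[F] S) := isArtinian_of_tower K inferInstance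
  have : Fintype (PrimeSpectrum (K ⊗[F] S)) := Fintype.ofFinite _
  let ψ := Algebra.FormallyEtale.equivPiOfIsSepClosed K (K ⊗[F] S)
  have hcard : Fintype.card (PrimeSpectrum (K ⊗[F] S)) = Module.finrank F S := by
    rw [← Module.finrank_baseChange (R := K), ψ.toLinearEquiv.finrank_eq]
    simp
  let σ : PrimeSpectrum (K ⊗[F] S) → S →ₐ[F] K := fun i =>
    ((Pi.evalAlgHom K (fun _ => K) i).comp ψ.toAlgHom).restrictScalars F |>.comp
      Algebra.TensorProduct.includeRight
  have hσ : Function.Injective σ := by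
    intro i j hij
    by_contra hne
    have h : (Pi.evalAlgHom K (fun _ => K) i).comp ψ.toAlgHom =
        (Pi.evalAlgHom K (fun _ => K) j).comp ψ.toAlgHom :=
      Algebra.TensorProduct.ext (by ext) hij
    classical
    have h2 := AlgHom.congr_fun h (ψ.symm (Pi.single i 1))
    simp [Ne.symm hne] at h2
  -- a generator is an element on which all geometric points take different values: it avoids
  -- finitely many proper subspaces
  let W : {q : PrimeSpectrum (K ⊗[F] S) × PrimeSpectrum (K ⊗[F] S) // q.1 ≠ q.2} →
      Subspace F S := fun q => LinearMap.eqLocus (σ q.1.1).toLinearMap (σ q.1.2).toLinearMap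
  obtain ⟨θ, hθ⟩ : ∃ θ, ∀ q, θ ∉ W q := by
    by_contra! h
    obtain ⟨q, hq⟩ := Subspace.exists_eq_top_of_iUnion_eq_univ (p := W)
      (Set.eq_univ_of_forall fun θ => Set.mem_iUnion.mpr (h θ))
    refine q.2 (hσ (AlgHom.ext fun s => ?_))
    exact (show s ∈ W q by rw [hq]; trivial)
  let e := (Fintype.equivFinOfCardEq hcard).symm
  refine ⟨θ, separable_of_injective_roots (K := K) (minpoly.monic (Algebra.IsIntegral.isIntegral θ))
    (minpoly.natDegree_le θ) (r := fun i => σ (e i) θ) (fun i j hij => ?_) fun i => ?_⟩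
  · by_contra hne
    exact hθ ⟨(e i, e j), fun h => hne (e.injective h)⟩ hij
  · rw [aeval_algHom_apply, minpoly.aeval, map_zero]

variable {A : Type u} [Ring A] [Algebra F A]

/-- Over an infinite field an étale subalgebra has a generator, whose minimal polynomial is then
separable. -/
lemma IsEtaleSubalgebra.exists_eq_adjoin [Infinite F] [FiniteDimensional F A] {n : ℕ}
    {E : Subalgebra F (F ⊗[F] A)} (hE : IsEtaleSubalgebra E) (hr : Module.finrank F E = n) :
    ∃ x, E = Algebra.adjoin F {x} ∧ (minpoly F x).natDegree = n ∧ (minpoly F x).Separable := by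
  obtain ⟨_, S, _, _, _, _, ⟨e⟩⟩ := hE
  obtain ⟨θ, hdeg, hsep⟩ := exists_separable_minpoly (F := F) (S := S)
  rw [e.toLinearEquiv.finrank_eq, hr] at hdeg
  let j : S →ₐ[F] F ⊗[F] A := E.val.comp e.toAlgHom
  have hj : Function.Injective j := Subtype.val_injective.comp e.injective
  have hmin : minpoly F (j θ) = minpoly F θ := minpoly.algHom_eq j hj θ
  refine ⟨j θ, ?_, by rw [hmin, hdeg], by rwa [hmin]⟩
  symm
  apply Subalgebra.eq_of_le_of_finrank_le
  · rw [Algebra.adjoin_le_iff, Set.singleton_subset_iff]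
    exact (e θ).2
  · rw [hr, ← hdeg, ← hmin, ← Fintype.card_fin (minpoly F (j θ)).natDegree,
      ← finrank_span_eq_card (linearIndependent_pow (K := F) (j θ))]
    refine Submodule.finrank_mono (t := Subalgebra.toSubmodule (Algebra.adjoin F {j θ})) ?_
    rw [Submodule.span_le]
    rintro _ ⟨i, rfl⟩
    exact pow_mem (Algebra.self_mem_adjoin_singleton F (j θ)) _

variable [Algebra.IsCentral F A] [IsSimpleRing A] [FiniteDimensional F A] {n : ℕ}

/-- If the powers `1, x, …, x ^ (n - 1)` are linearly independent, then Cramer's rule with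
respect to the dual functionals gives a monic polynomial of degree `n` with root `x`. -/
lemma natDegree_minpoly_le (hn : Module.finrank F A = n ^ 2) (x : F ⊗[F] A) :
    (minpoly F x).natDegree ≤ n := by
  by_contra! hlt
  obtain ⟨δ, hδ⟩ := exists_dual_pow hlt.le
  have hcoeff : (cramerPoly x δ).coeff n = 1 := by
    rw [coeff_cramerPoly]
    convert Matrix.det_one (n := Fin n)
    ext i j
    simp [hδ, Matrix.one_apply]
  have hne : cramerPoly x δ ≠ 0 := fun h => by simp [h] at hcoeff
  exact absurd ((natDegree_le_of_dvd (minpoly.dvd F x (aeval_cramerPoly hn x δ)) hne).trans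
    (natDegree_cramerPoly_le x δ)) hlt.not_ge

/-- The discriminant of the characteristic polynomial is a polynomial function on `A` that does not
vanish at the diagonal matrices with distinct entries, over an algebraic closure. Over an infinite
field it is therefore nonzero at some element of `A`. -/
lemma exists_minpoly_separable [Infinite F] (hn : Module.finrank F A = n ^ 2) :
    ∃ x : F ⊗[F] A, (minpoly F x).natDegree = n ∧ (minpoly F x).Separable := by
  classical
  let K := AlgebraicClosure F
  obtain ⟨φ⟩ := exists_algEquiv_matrix_baseChange hn K
  let b := Module.finBasis F A
  let M : Matrix (Fin n) (Fin n) (MvPolynomial (Fin (Module.finrank F A)) K) :=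
    ∑ i, (MvPolynomial.X i : MvPolynomial (Fin (Module.finrank F A)) K) •
      (φ (1 ⊗ₜ b i)).map MvPolynomial.C
  -- the discriminant of the characteristic polynomial of the generic element `M`
  let D := resultant M.charpoly (derivative M.charpoly) n n
  have hM : ∀ c, M.map (MvPolynomial.eval c) = φ (∑ i, c i ⊗ₜ b i) := by
    intro c
    have h : ∀ i, φ (c i ⊗ₜ b i) = c i • φ (1 ⊗ₜ b i) := fun i => by
      rw [← map_smul, TensorProduct.smul_tmul', smul_eq_mul, mul_one]
    ext i j
    simp [M, h, Matrix.sum_apply]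
  have hD : ∀ c, MvPolynomial.eval c D = resultant (φ (∑ i, c i ⊗ₜ b i)).charpoly
      (derivative (φ (∑ i, c i ⊗ₜ b i)).charpoly) n n := by
    intro c
    rw [← hM, Matrix.charpoly_map, derivative_map, resultant_map_map]
  have hD0 : D ≠ 0 := by
    intro h
    let r : Fin n → K := fun i => Infinite.natEmbedding K i
    have hr : Function.Injective r := fun i j h => Fin.ext ((Infinite.natEmbedding K).injective h)
    have hsep : (Matrix.diagonal r).charpoly.Separable := by
      rw [Matrix.charpoly_diagonal]
      exact separable_prod_X_sub_C_iff.mpr hr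
    have h2 := resultant_derivative_ne_zero (Matrix.charpoly_monic (Matrix.diagonal r)) hsep
    let c := (b.baseChange K).repr (φ.symm (Matrix.diagonal r))
    have hc : φ (∑ i, c i ⊗ₜ b i) = Matrix.diagonal r := by
      have h3 := (b.baseChange K).sum_repr (φ.symm (Matrix.diagonal r))
      have h4 : ∑ i, c i ⊗ₜ[F] b i = φ.symm (Matrix.diagonal r) := by
        simpa [Module.Basis.baseChange_apply, TensorProduct.smul_tmul', c] using h3
      rw [h4, φ.apply_symm_apply]
    have h3 := hD c
    rw [h, map_zero, hc] at h3
    rw [Matrix.charpoly_natDegree_eq_dim, Fintype.card_fin] at h2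
    exact h2 h3.symm
  obtain ⟨c, hc⟩ : ∃ c : Fin (Module.finrank F A) → F,
      MvPolynomial.eval (fun i => algebraMap F K (c i)) D ≠ 0 := by
    by_contra! h
    refine hD0 (MvPolynomial.funext_set (fun _ => Set.range (algebraMap F K))
      (fun _ => Set.infinite_range_of_injective (algebraMap F K).injective) fun x hx => ?_)
    choose c hc using fun i => hx i trivial
    obtain rfl : (fun i => algebraMap F K (c i)) = x := funext hc
    rw [h, map_zero]
  let a : A := ∑ i, c i • b i
  let q := (φ (1 ⊗ₜ a)).charpoly
  have hqdeg : q.natDegree = n := by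
    rw [Matrix.charpoly_natDegree_eq_dim, Fintype.card_fin]
  have hq : q.Separable := by
    have ha : ∑ i, algebraMap F K (c i) ⊗ₜ[F] b i = 1 ⊗ₜ a := by
      rw [TensorProduct.tmul_sum]
      refine Finset.sum_congr rfl fun i _ => ?_
      rw [TensorProduct.tmul_smul, TensorProduct.smul_tmul', Algebra.algebraMap_eq_smul_one]
    rw [hD, ha] at hc
    refine (Matrix.charpoly_monic _).separable_of_isUnit_resultant (isUnit_iff_ne_zero.mpr ?_)
    rwa [hqdeg]
  have hcard : q.roots.toFinset.card = n := by
    rw [Multiset.toFinset_card_of_nodup (nodup_roots hq), ← hqdeg]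
    exact (IsAlgClosed.splits q).natDegree_eq_card_roots.symm
  let e := (Finset.equivFinOfCardEq hcard).symm
  have hint : IsIntegral F (1 ⊗ₜ[F] a : F ⊗[F] A) := Algebra.IsIntegral.isIntegral _
  refine ⟨1 ⊗ₜ a, separable_of_injective_roots (minpoly.monic hint) (natDegree_minpoly_le hn _)
    (r := fun i => (e i : K)) (Subtype.val_injective.comp e.injective) fun i => ?_⟩
  have hmem : (e i : K) ∈ spectrum K (φ (1 ⊗ₜ a)) := by
    rw [Matrix.mem_spectrum_iff_isRoot_charpoly]
    exact isRoot_of_mem_roots (Multiset.mem_toFinset.mp (e i).2)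
  have h0 : aeval (φ (1 ⊗ₜ a)) ((minpoly F (1 ⊗ₜ[F] a : F ⊗[F] A)).map (algebraMap F K)) = 0 := by
    have h := map_aeval_tensor (Algebra.ofId F K) (1 ⊗ₜ[F] a : F ⊗[F] A)
      (minpoly F (1 ⊗ₜ[F] a : F ⊗[F] A))
    rw [minpoly.aeval, map_zero, Algebra.TensorProduct.map_tmul, map_one] at h
    rw [aeval_algHom_apply]
    exact (congrArg φ h.symm).trans (map_zero φ)
  have h1 := spectrum.subset_polynomial_aeval (φ (1 ⊗ₜ a))
    ((minpoly F (1 ⊗ₜ[F] a : F ⊗[F] A)).map (algebraMap F K)) ⟨_, hmem, rfl⟩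
  have : Nonempty (Fin n) := ⟨i⟩
  rw [h0, spectrum.zero_eq, Set.mem_singleton_iff] at h1
  exact (eval_map_algebraMap (minpoly F (1 ⊗ₜ[F] a : F ⊗[F] A)) (e i : K)).symm.trans h1

lemma isRTrivial_et_of_infinite [Infinite F] (hn : Module.finrank F A = n ^ 2) :
    IsRTrivial (et F A n n) := by
  refine isRTrivial_et hn ?_ fun E₀ E₁ h₀ hr₀ h₁ hr₁ => ?_
  · obtain ⟨x, hdeg, hsep⟩ := exists_minpoly_separable (A := A) hn
    obtain ⟨h, h0, h1, E, hE, ⟨b⟩, hp, -⟩ := subalgebraLinked_adjoin hn hdeg hsep hdeg hsep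
    refine ⟨_, hp ▸ hE.pullback _, ?_⟩
    rw [← hp, finrank_pullbackSubalgebra _ E b hE.1, Fintype.card_fin]
  · obtain ⟨x₀, rfl, hdeg₀, hsep₀⟩ := h₀.exists_eq_adjoin hr₀
    obtain ⟨x₁, rfl, hdeg₁, hsep₁⟩ := h₁.exists_eq_adjoin hr₁
    exact .rel _ _ (subalgebraLinked_adjoin hn hdeg₀ hsep₀ hdeg₁ hsep₁)

end Infinite

/-! ### Étale algebras acting on themselves -/

section Specialization

/-- A basis `b` of an `R`-algebra `S` specializes along `g : R → R'` to a basis `b'` of an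
`R'`-algebra `S'` if some ring homomorphism `S → S'` over `g` maps `b` to `b'`; thus `S'` is the
base change of `S`. -/
def BasisSpecializes {ι R R' S S' : Type*} [CommRing R] [CommRing R'] [CommRing S] [CommRing S']
    [Algebra R S] [Algebra R' S'] (g : R →+* R') (b : Module.Basis ι R S)
    (b' : Module.Basis ι R' S') : Prop :=
  ∃ γ : S →+* S', (∀ r s, γ (r • s) = g r • γ s) ∧ ∀ i, γ (b i) = b' i

variable {ι κ R R' S S' T T' : Type*} [CommRing R] [CommRing R'] [CommRing S] [CommRing S']
  [CommRing T] [CommRing T'] [Algebra R S] [Algebra R' S'] [Algebra R T] [Algebra R' T']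
  {g : R →+* R'} {b : Module.Basis ι R S} {b' : Module.Basis ι R' S'}
  {c : Module.Basis κ R T} {c' : Module.Basis κ R' T'}

lemma BasisSpecializes.prod (hb : BasisSpecializes g b b') (hc : BasisSpecializes g c c') :
    BasisSpecializes g (b.prod c) (b'.prod c') := by
  obtain ⟨γ, hγ, hγb⟩ := hb
  obtain ⟨δ, hδ, hδc⟩ := hc
  refine ⟨γ.prodMap δ, fun r s => by simp [Prod.ext_iff, hγ, hδ], ?_⟩
  rintro (i | i) <;> ext <;> simp [hγb, hδc]

lemma BasisSpecializes.reindex (hb : BasisSpecializes g b b') (e : ι ≃ κ) :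
    BasisSpecializes g (b.reindex e) (b'.reindex e) := by
  obtain ⟨γ, hγ, hγb⟩ := hb
  exact ⟨γ, hγ, fun i => by simp [hγb]⟩

end Specialization

section MulSubalgebra

variable {F : Type u} [Field F] {A : Type u} [Ring A] [Algebra F A] {n : ℕ}
  (θ : A ≃ₐ[F] Matrix (Fin n) (Fin n) F)

/-- The base change to `R` of an isomorphism of `A` with a matrix algebra. -/
def matrixEquivBaseChange (R : Type u) [CommRing R] [Algebra F R] :
    R ⊗[F] A ≃ₐ[R] Matrix (Fin n) (Fin n) R :=
  AlgEquiv.ofRingEquiv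
    (f := ((Algebra.TensorProduct.congr (AlgEquiv.refl (R := F) (A₁ := R)) θ).trans
    (matrixEquivTensor (Fin n) F R).symm).toRingEquiv) fun r => by
      change (matrixEquivTensor (Fin n) F R).symm (r ⊗ₜ θ 1) = _
      rw [map_one, matrixEquivTensor_apply_symm, Matrix.map_one _ (map_zero _) (map_one _),
        Algebra.algebraMap_eq_smul_one]

lemma matrixEquivBaseChange_tmul {R : Type u} [CommRing R] [Algebra F R] (r : R) (a : A) :
    matrixEquivBaseChange θ R (r ⊗ₜ a) = r • (θ a).map (algebraMap F R) := rfl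

lemma matrixEquivBaseChange_map {R R' : Type u} [CommRing R] [Algebra F R] [CommRing R']
    [Algebra F R'] (g : R →ₐ[F] R') (x : R ⊗[F] A) :
    matrixEquivBaseChange θ R' (Algebra.TensorProduct.map g (AlgHom.id F A) x) =
      (matrixEquivBaseChange θ R x).map g := by
  induction x with
  | zero => ext; simp
  | tmul r a => ext; simp [matrixEquivBaseChange_tmul]
  | add x y hx hy => ext; simp [hx, hy]

variable {R : Type u} [CommRing R] [Algebra F R] {S : Type u} [CommRing S] [Algebra R S]

/-- The embedding of a commutative `R`-algebra `S` with a basis of `n` elements into a matrix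
algebra of degree `n` by its multiplication operators. -/
def mulEmbedding (b : Module.Basis (Fin n) R S) : S →ₐ[R] R ⊗[F] A :=
  (matrixEquivBaseChange θ R).symm.toAlgHom.comp (Algebra.leftMulMatrix b)

/-- The coordinates of `1` are a cyclic vector for the image of `mulEmbedding`. -/
lemma exists_mulEmbedding_retraction (b : Module.Basis (Fin n) R S) :
    ∃ P : R ⊗[F] A →ₗ[R] S, ∀ s, P (mulEmbedding θ b s) = s := by
  refine ⟨b.equivFun.symm.toLinearMap ∘ₗ (Matrix.mulVecBilin R R).flip (b.equivFun 1) ∘ₗ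
    (matrixEquivBaseChange θ R).toLinearMap, fun s => ?_⟩
  have h : Matrix.mulVec (Algebra.leftMulMatrix b s) (b.equivFun 1) = b.equivFun s := by
    have := Algebra.leftMulMatrix_mulVec_repr b s 1
    rwa [mul_one] at this
  change b.equivFun.symm (Matrix.mulVec (matrixEquivBaseChange θ R
    ((matrixEquivBaseChange θ R).symm (Algebra.leftMulMatrix b s))) (b.equivFun 1)) = s
  rw [AlgEquiv.apply_symm_apply, h, LinearEquiv.symm_apply_apply]

lemma isEtaleSubalgebra_range_mulEmbedding [Algebra.Etale R S] (b : Module.Basis (Fin n) R S) :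
    IsEtaleSubalgebra (mulEmbedding θ b).range ∧
      Nonempty (Module.Basis (Fin n) R (mulEmbedding θ b).range) := by
  have := Module.Finite.of_basis b
  obtain ⟨P, hP⟩ := exists_mulEmbedding_retraction θ b
  exact ⟨isEtaleSubalgebra_range _ P hP, ⟨b.map (AlgEquiv.ofInjective (mulEmbedding θ b)
    (Function.LeftInverse.injective hP)).toLinearEquiv⟩⟩

lemma range_mulEmbedding_map {S' : Type u} [CommRing S'] [Algebra R S']
    (b : Module.Basis (Fin n) R S) (e : S ≃ₐ[R] S') :
    (mulEmbedding θ (b.map e.toLinearEquiv)).range = (mulEmbedding θ b).range := by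
  have h : ∀ s, mulEmbedding θ (b.map e.toLinearEquiv) (e s) = mulEmbedding θ b s := by
    intro s
    refine congrArg (matrixEquivBaseChange θ R).symm ?_
    ext i j
    change Algebra.leftMulMatrix (b.map e.toLinearEquiv) (e s) i j = Algebra.leftMulMatrix b s i j
    rw [Algebra.leftMulMatrix_eq_repr_mul, Algebra.leftMulMatrix_eq_repr_mul]
    simp [← map_mul]
  ext x
  constructor
  · rintro ⟨s, rfl⟩
    exact ⟨e.symm s, (h _).symm.trans (congrArg _ (e.apply_symm_apply s))⟩
  · rintro ⟨s, rfl⟩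
    exact ⟨e s, h s⟩

lemma BasisSpecializes.pullbackSubalgebra {R' : Type u} [CommRing R'] [Algebra F R'] {S' : Type u}
    [CommRing S'] [Algebra R' S'] {g : R →ₐ[F] R'} {b : Module.Basis (Fin n) R S}
    {b' : Module.Basis (Fin n) R' S'} (hb : BasisSpecializes g.toRingHom b b') :
    pullbackSubalgebra g (mulEmbedding (A := A) θ b).range = (mulEmbedding θ b').range := by
  obtain ⟨γ, hγ, hγb⟩ := hb
  have hrepr : ∀ s i, b'.repr (γ s) i = g (b.repr s i) := by
    intro s i
    conv_lhs => rw [← b.sum_repr s]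
    rw [map_sum]
    simp [hγ, hγb, Finsupp.single_apply]
  have h : ∀ s, Algebra.TensorProduct.map g (AlgHom.id F A) (mulEmbedding θ b s) =
      mulEmbedding θ b' (γ s) := by
    intro s
    apply (matrixEquivBaseChange θ R').injective
    rw [matrixEquivBaseChange_map]
    change ((matrixEquivBaseChange θ R) ((matrixEquivBaseChange θ R).symm _)).map g =
      (matrixEquivBaseChange θ R') ((matrixEquivBaseChange θ R').symm _)
    rw [AlgEquiv.apply_symm_apply, AlgEquiv.apply_symm_apply]
    ext i j
    change g (Algebra.leftMulMatrix b s i j) = Algebra.leftMulMatrix b' (γ s) i j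
    rw [Algebra.leftMulMatrix_eq_repr_mul, Algebra.leftMulMatrix_eq_repr_mul, ← hγb, ← map_mul,
      hrepr]
  apply le_antisymm
  · refine Algebra.adjoin_le ?_
    rintro _ ⟨_, ⟨s, rfl⟩, rfl⟩
    exact ⟨γ s, (h s).symm⟩
  · rintro _ ⟨s', rfl⟩
    change mulEmbedding θ b' s' ∈ _
    rw [← b'.sum_repr s', map_sum]
    refine Subalgebra.sum_mem _ fun i _ => ?_
    rw [map_smul, ← hγb, ← h]
    exact Subalgebra.smul_mem _ (Algebra.subset_adjoin
      (Set.mem_image_of_mem _ ((mulEmbedding θ b).mem_range_self (b i)))) _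

end MulSubalgebra

/-! ### Matrix algebras over fields -/

section Split

variable {F : Type u} [Field F] {A : Type u} [Ring A] [Algebra F A] {n : ℕ}

/-- A central simple algebra over a finite field is a matrix algebra. -/
lemma exists_algEquiv_matrix_of_finite [Finite F] [Algebra.IsCentral F A] [IsSimpleRing A]
    [FiniteDimensional F A] (hn : Module.finrank F A = n ^ 2) :
    Nonempty (A ≃ₐ[F] Matrix (Fin n) (Fin n) F) := by
  have : IsArtinianRing A := isArtinian_of_tower F inferInstance
  obtain ⟨m, _, D, _, _, _, ⟨φ⟩⟩ := IsSimpleRing.exists_algEquiv_matrix_divisionRing_finite F A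
  have : Finite D := Module.finite_of_finite F
  let _ : Field D := littleWedderburn D
  have hsurj : Function.Surjective (algebraMap F D) := by
    intro d
    have h : φ.symm (Matrix.scalar (Fin m) d) ∈ Subalgebra.center F A := by
      rw [Subalgebra.mem_center_iff]
      intro a
      apply φ.injective
      rw [map_mul, map_mul, φ.apply_symm_apply]
      exact ((Matrix.scalar_commute d (fun _ => mul_comm _ _) (φ a)).eq).symm
    rw [Algebra.IsCentral.center_eq_bot] at h
    obtain ⟨c, hc⟩ := Algebra.mem_bot.mp h
    have h2 := (φ.symm_apply_eq.mp hc.symm).trans (φ.commutes c)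
    exact ⟨c, by simpa [Matrix.algebraMap_matrix_apply] using (congrFun (congrFun h2 0) 0).symm⟩
  let ε : F ≃ₐ[F] D := AlgEquiv.ofBijective (Algebra.ofId F D)
    ⟨(algebraMap F D).injective, hsurj⟩
  let ψ : A ≃ₐ[F] Matrix (Fin m) (Fin m) F := φ.trans ε.symm.mapMatrix
  have h := ψ.toLinearEquiv.finrank_eq
  rw [hn, Module.finrank_matrix] at h
  have : n = m := by simpa [← pow_two] using h
  exact ⟨this ▸ ψ⟩

/-- Every étale subalgebra of rank `n` of a matrix algebra of degree `n` has a cyclic vector, hence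
is the algebra of multiplication operators of an étale algebra with respect to some basis. -/
lemma IsEtaleSubalgebra.exists_eq_range_mulEmbedding (θ : A ≃ₐ[F] Matrix (Fin n) (Fin n) F)
    {E : Subalgebra F (F ⊗[F] A)} (hE : IsEtaleSubalgebra E) (hr : Module.finrank F E = n) :
    ∃ (S : Type u) (_ : CommRing S) (_ : Algebra F S) (_ : Algebra.Etale F S)
      (b : Module.Basis (Fin n) F S), E = (mulEmbedding θ b).range := by
  classical
  obtain ⟨_, S, _, _, _, _, ⟨e⟩⟩ := hE
  obtain ⟨I, _, K, _, _, ε, -⟩ := (Algebra.Etale.iff_exists_algEquiv_prod F S).mp inferInstance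
  have := Fintype.ofFinite I
  let Θ := matrixEquivBaseChange θ F
  let j : S →ₐ[F] Matrix (Fin n) (Fin n) F := Θ.toAlgHom.comp (E.val.comp e.toAlgHom)
  have hj : Function.Injective j :=
    Θ.injective.comp (Subtype.val_injective.comp e.injective)
  -- a vector with a nonzero component in the image of each minimal idempotent
  have hw : ∀ i, ∃ w, (j (ε.symm (Pi.single i 1))).mulVec w ≠ 0 := by
    intro i
    by_contra! h
    have h0 : j (ε.symm (Pi.single i 1)) = 0 :=
      Matrix.ext_of_mulVec_single fun k => by rw [h, Matrix.zero_mulVec]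
    rw [map_eq_zero_iff j hj, map_eq_zero_iff _ ε.symm.injective] at h0
    simp at h0
  choose w hw using hw
  let v := ∑ i, (j (ε.symm (Pi.single i 1))).mulVec (w i)
  let f : S →ₗ[F] (Fin n → F) := (Matrix.mulVecBilin F F).flip v ∘ₗ j.toLinearMap
  have hf : ∀ s, f s = (j s).mulVec v := fun s => rfl
  have hinj : Function.Injective f := by
    rw [injective_iff_map_eq_zero]
    intro s hs
    by_contra hne
    obtain ⟨i, hi⟩ : ∃ i, ε s i ≠ 0 := by
      by_contra! h
      exact hne (ε.injective ((funext h).trans (map_zero ε).symm))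
    apply hw i
    have h1 : ∀ k, j (ε.symm (Pi.single i (ε s i)⁻¹)) * j s * j (ε.symm (Pi.single k 1)) =
        if k = i then j (ε.symm (Pi.single i 1)) else 0 := by
      intro k
      rw [← map_mul, ← map_mul]
      have h2 : Pi.single i (ε s i)⁻¹ * ε s * Pi.single k 1 =
          if k = i then Pi.single i (1 : K i) else 0 := by
        split_ifs with h
        · subst h
          ext l
          by_cases hl : l = k
          · subst hl; simp [hi]
          · simp [hl]
        · ext l
          by_cases hl : l = i
          · subst hl; simp [Ne.symm h]
          · simp [hl]
      have h4 : ε.symm (Pi.single i (ε s i)⁻¹) * s * ε.symm (Pi.single k 1) =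
          ε.symm (if k = i then Pi.single i (1 : K i) else 0) :=
        ε.injective (by simp only [map_mul, ε.apply_symm_apply, h2])
      rw [h4]
      split_ifs <;> simp
    have h3 : (j (ε.symm (Pi.single i (ε s i)⁻¹)) * j s).mulVec v = 0 := by
      rw [← Matrix.mulVec_mulVec, ← hf, hs, Matrix.mulVec_zero]
    rw [Matrix.mulVec_sum] at h3
    simp only [Matrix.mulVec_mulVec, h1] at h3
    rw [Finset.sum_eq_single i (fun k _ hk => by rw [if_neg hk, Matrix.zero_mulVec]) (by simp),
      if_pos rfl] at h3
    exact h3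
  have hdim : Module.finrank F S = Module.finrank F (Fin n → F) := by
    rw [e.toLinearEquiv.finrank_eq, hr, Module.finrank_fin_fun]
  let f' : S ≃ₗ[F] (Fin n → F) := LinearEquiv.ofInjectiveOfFinrankEq f hinj hdim
  have hf' : ∀ s, f' s = f s := fun s => rfl
  let b : Module.Basis (Fin n) F S := (Pi.basisFun F (Fin n)).map f'.symm
  have hb : ∀ s, mulEmbedding θ b s = e s := by
    intro s
    refine Θ.injective ((Θ.apply_symm_apply _).trans ?_)
    ext i k
    change Algebra.leftMulMatrix b s i k = j s i k
    rw [Algebra.leftMulMatrix_eq_repr_mul]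
    have h1 : b.repr (s * b k) i = f (s * b k) i := by simp [b, hf']
    have h2 : f (b k) = Pi.single k 1 := by rw [← hf']; simp [b]
    rw [h1, hf, map_mul, ← Matrix.mulVec_mulVec, ← hf, h2]
    simp
  refine ⟨S, inferInstance, inferInstance, inferInstance, b, ?_⟩
  ext x
  constructor
  · intro hx
    exact ⟨e.symm ⟨x, hx⟩, (hb _).trans (congrArg Subtype.val (e.apply_symm_apply _))⟩
  · rintro ⟨s, rfl⟩
    exact (hb s).symm ▸ (e s).2

end Split

/-! ### Deformations of étale algebras -/

section Connected

open Polynomial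

lemma etale_prod (R : Type*) {S T : Type u} [CommRing R] [CommRing S] [CommRing T] [Algebra R S]
    [Algebra R T] [Algebra.Etale R S] [Algebra.Etale R T] : Algebra.Etale R (S × T) := by
  let P : Fin 2 → Type u := Fin.cons S fun _ => T
  let _ : ∀ i, CommRing (P i) := Fin.cons ‹CommRing S› fun _ => ‹CommRing T›
  let _ : ∀ i, Algebra R (P i) := Fin.cons ‹Algebra R S› fun _ => ‹Algebra R T›
  have : ∀ i, Algebra.Etale R (P i) := Fin.cons ‹Algebra.Etale R S› fun _ => ‹Algebra.Etale R T›
  exact Algebra.Etale.of_equiv (AlgEquiv.ofRingEquiv (f := RingEquiv.piFinTwo P) fun _ => rfl :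
    (∀ i, P i) ≃ₐ[R] S × T)

variable {F : Type u} [Field F]

/-- The powers of the root as a basis of the algebra defined by a monic polynomial of degree `m`. -/
def adjoinRootBasis {R : Type u} [CommRing R] {m : ℕ} {p : R[X]} (hp : p.Monic)
    (hdeg : p.natDegree = m) : Module.Basis (Fin m) R (AdjoinRoot p) :=
  (AdjoinRoot.powerBasis' hp).basis.reindex (finCongr hdeg)

lemma adjoinRootBasis_apply {R : Type u} [CommRing R] {m : ℕ} {p : R[X]} (hp : p.Monic)
    (hdeg : p.natDegree = m) (i : Fin m) :
    adjoinRootBasis hp hdeg i = AdjoinRoot.root p ^ (i : ℕ) := by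
  subst hdeg
  rw [adjoinRootBasis, Module.Basis.reindex_apply]
  exact (AdjoinRoot.powerBasis' hp).basis_eq_pow i

lemma basisSpecializes_adjoinRoot {R R' : Type u} [CommRing R] [CommRing R'] (g : R →+* R') {m : ℕ}
    {p : R[X]} (hp : p.Monic) (hdeg : p.natDegree = m) {q : R'[X]} (hq : q.Monic)
    (hqdeg : q.natDegree = m) (hpq : p.map g = q) :
    BasisSpecializes g (adjoinRootBasis hp hdeg) (adjoinRootBasis hq hqdeg) := by
  refine ⟨AdjoinRoot.map g p q hpq.symm.dvd, fun r s => ?_, fun i => ?_⟩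
  · rw [Algebra.smul_def, Algebra.smul_def, map_mul, AdjoinRoot.algebraMap_eq, AdjoinRoot.map_of]
    rfl
  · rw [adjoinRootBasis_apply, adjoinRootBasis_apply, map_pow, AdjoinRoot.map_root]

/-- The ring homomorphism `R ⊗ T → T` over an `F`-point of `R`. -/
def tensorEval {R : Type u} [CommRing R] [Algebra F R] (g : R →ₐ[F] F) (T : Type u) [CommRing T]
    [Algebra F T] : R ⊗[F] T →ₐ[F] T :=
  Algebra.TensorProduct.lift ((Algebra.ofId F T).comp g) (AlgHom.id F T) fun _ _ => .all _ _

lemma tensorEval_smul {R : Type u} [CommRing R] [Algebra F R] (g : R →ₐ[F] F) (T : Type u)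
    [CommRing T] [Algebra F T] (r : R) (s : R ⊗[F] T) :
    tensorEval g T (r • s) = g r • tensorEval g T s := by
  rw [Algebra.smul_def, map_mul, Algebra.smul_def]
  simp [tensorEval, Algebra.TensorProduct.algebraMap_apply, Algebra.ofId_apply]

lemma basisSpecializes_of_tensorEval {R : Type u} [CommRing R] [Algebra F R] (g : R →ₐ[F] F)
    {T : Type u} [CommRing T] [Algebra F T] {κ : Type*} {b : Module.Basis κ R (R ⊗[F] T)}
    {c : Module.Basis κ F T} (h : ∀ i, tensorEval g T (b i) = c i) :
    BasisSpecializes g.toRingHom b c :=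
  ⟨(tensorEval g T).toRingHom, tensorEval_smul g T, h⟩

lemma basisSpecializes_baseChange {R : Type u} [CommRing R] [Algebra F R] (g : R →ₐ[F] F)
    {T : Type u} [CommRing T] [Algebra F T] {κ : Type*} (c : Module.Basis κ F T) :
    BasisSpecializes g.toRingHom (c.baseChange R) c :=
  basisSpecializes_of_tensorEval g fun i => by
    rw [Module.Basis.baseChange_apply]
    exact (Algebra.TensorProduct.lift_tmul ..).trans (by simp)

variable {A : Type u} [Ring A] [Algebra F A] {n : ℕ} (θ : A ≃ₐ[F] Matrix (Fin n) (Fin n) F)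

lemma subalgebraLinked_of_basisSpecializes {h : F[X]} (h0 : h.eval 0 ≠ 0) (h1 : h.eval 1 ≠ 0)
    {S S₀ S₁ : Type u} [CommRing S] [CommRing S₀] [CommRing S₁] [Algebra (Localization.Away h) S]
    [Algebra F S₀] [Algebra F S₁] [Algebra.Etale (Localization.Away h) S]
    {b : Module.Basis (Fin n) (Localization.Away h) S} {b₀ : Module.Basis (Fin n) F S₀}
    {b₁ : Module.Basis (Fin n) F S₁} (hb₀ : BasisSpecializes (evalAway h 0 h0).toRingHom b b₀)
    (hb₁ : BasisSpecializes (evalAway h 1 h1).toRingHom b b₁) :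
    SubalgebraLinked n (mulEmbedding (A := A) θ b₀).range (mulEmbedding θ b₁).range :=
  ⟨h, h0, h1, (mulEmbedding θ b).range, (isEtaleSubalgebra_range_mulEmbedding θ b).1,
    (isEtaleSubalgebra_range_mulEmbedding θ b).2, hb₀.pullbackSubalgebra θ,
    hb₁.pullbackSubalgebra θ⟩

/-- The line through two bases links the corresponding embeddings of an étale algebra. -/
lemma subalgebraLinked_of_basis {S : Type u} [CommRing S] [Algebra F S] [Algebra.Etale F S]
    (b₀ b₁ : Module.Basis (Fin n) F S) :
    SubalgebraLinked n (mulEmbedding (A := A) θ b₀).range (mulEmbedding θ b₁).range := by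
  let Q := b₀.toMatrix b₁
  let P : Matrix (Fin n) (Fin n) F[X] := (1 - X : F[X]) • 1 + (X : F[X]) • Q.map C
  have hP : ∀ s : F, P.map (aeval s) = (1 - s) • 1 + s • Q := by
    intro s
    ext i j
    simp [P, Matrix.one_apply, apply_ite, mul_comm s]
  have hdet : ∀ s : F, P.det.eval s = ((1 - s) • 1 + s • Q).det := by
    intro s
    rw [← hP, ← coe_aeval_eq_eval, AlgHom.map_det]
    rfl
  have hQ : Q.det ≠ 0 := by
    have := b₀.invertibleToMatrix b₁
    exact ((Matrix.isUnit_iff_isUnit_det _).mp (isUnit_of_invertible Q)).ne_zero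
  have h0 : P.det.eval 0 ≠ 0 := by simp [hdet]
  have h1 : P.det.eval 1 ≠ 0 := by simpa [hdet] using hQ
  let R := Localization.Away P.det
  let PR := P.map (algebraMap F[X] R)
  have hPR : IsUnit PR.det := by
    have h := IsLocalization.Away.algebraMap_isUnit (S := R) P.det
    rwa [RingHom.map_det] at h
  let b : Module.Basis (Fin n) R (R ⊗[F] S) := (b₀.baseChange R).map
    (PR.toLinearEquiv (b₀.baseChange R) hPR)
  have hb : ∀ (s : F) (hs : P.det.eval s ≠ 0) i, tensorEval (evalAway P.det s hs) S (b i) =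
      ∑ j, (((1 - s) • 1 + s • Q : Matrix (Fin n) (Fin n) F) j i) • b₀ j := by
    intro s hs i
    have h : b i = ∑ j, PR j i • (1 : R) ⊗ₜ[F] b₀ j := by
      have h2 := Matrix.toLin_self (b₀.baseChange R) (b₀.baseChange R) PR i
      simp only [Module.Basis.baseChange_apply] at h2
      rw [← h2]
      exact congrArg (Matrix.toLin (b₀.baseChange R) (b₀.baseChange R) PR)
        (Module.Basis.baseChange_apply ..)
    rw [h, map_sum]
    refine Finset.sum_congr rfl fun j _ => ?_
    rw [tensorEval_smul, ← hP]
    congr 1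
    · exact (evalAway_algebraMap ..).trans (coe_aeval_eq_eval s ▸ rfl)
    · exact (Algebra.TensorProduct.lift_tmul ..).trans (by simp)
  refine subalgebraLinked_of_basisSpecializes θ h0 h1 (b := b)
    (basisSpecializes_of_tensorEval _ fun i => ?_) (basisSpecializes_of_tensorEval _ fun i => ?_)
  · rw [hb]
    simp [Matrix.one_apply]
  · rw [hb]
    simp [Q, b₀.sum_toMatrix_smul_self]

/-- Two commutative `F`-algebras of dimension `n` are connected if all their embeddings as algebras
of multiplication operators into `A` are connected by chains of families over open subsets of the
affine line. -/
def AlgConnected (S T : Type u) [CommRing S] [Algebra F S] [CommRing T] [Algebra F T] : Prop :=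
  ∀ (b : Module.Basis (Fin n) F S) (c : Module.Basis (Fin n) F T),
    Relation.EqvGen (SubalgebraLinked n) (mulEmbedding (A := A) θ b).range (mulEmbedding θ c).range

variable {S T U : Type u} [CommRing S] [Algebra F S] [CommRing T] [Algebra F T] [CommRing U]
  [Algebra F U]

variable {θ} in
lemma AlgConnected.symm (h : AlgConnected θ S T) : AlgConnected θ T S :=
  fun b c => .symm _ _ (h c b)

variable {θ} in
lemma AlgConnected.trans (h : AlgConnected θ S T) (h' : AlgConnected θ T U)
    (c : Module.Basis (Fin n) F T) : AlgConnected θ S U :=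
  fun b d => .trans _ _ _ (h b c) (h' c d)

lemma algConnected_of_algEquiv [Algebra.Etale F S] (e : S ≃ₐ[F] T) : AlgConnected θ S T :=
  fun b c => by
    rw [← range_mulEmbedding_map θ c e.symm]
    exact .rel _ _ (subalgebraLinked_of_basis θ b (c.map e.symm.toLinearEquiv))

lemma algConnected_of_subalgebraLinked [Algebra.Etale F S] [Algebra.Etale F T]
    {b : Module.Basis (Fin n) F S} {c : Module.Basis (Fin n) F T}
    (h : SubalgebraLinked n (mulEmbedding (A := A) θ b).range (mulEmbedding θ c).range) :
    AlgConnected θ S T :=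
  fun b' c' => .trans _ _ _ (.rel _ _ (subalgebraLinked_of_basis θ b' b))
    (.trans _ _ _ (.rel _ _ h) (.rel _ _ (subalgebraLinked_of_basis θ c c')))

/-- The line through two separable polynomials of the same degree connects the algebras that they
define, also after adding a fixed factor. -/
lemma algConnected_adjoinRoot_prod {f g : F[X]} (hf : f.Monic) (hg : g.Monic) (hfs : f.Separable)
    (hgs : g.Separable) (hfg : f.natDegree = g.natDegree) [Algebra.Etale F T]
    (hn : g.natDegree + Module.finrank F T = n) :
    AlgConnected θ (AdjoinRoot f × T) (AdjoinRoot g × T) := by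
  have : Module.Finite F T := Algebra.FormallyUnramified.finite_of_free F T
  have := etale_adjoinRoot hf hfs
  have := etale_adjoinRoot hg hgs
  let p : F[X][X] := C (1 - X : F[X]) * f.map C + C (X : F[X]) * g.map C
  have hle : p.natDegree ≤ g.natDegree := by
    refine natDegree_add_le_of_degree_le ?_ ?_ <;>
      refine (natDegree_C_mul_le _ _).trans (natDegree_map_le.trans ?_)
    exacts [hfg.le, le_rfl]
  have hcoeff : p.coeff g.natDegree = 1 := by
    have h1 : f.coeff g.natDegree = 1 := hfg ▸ hf
    have h2 : g.coeff g.natDegree = 1 := hg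
    simp only [p, coeff_add, coeff_C_mul, coeff_map, h1, h2]
    simp
  have hp : p.Monic := monic_of_natDegree_le_of_coeff_eq_one _ hle hcoeff
  have hpdeg : p.natDegree = g.natDegree :=
    natDegree_eq_of_le_of_coeff_ne_zero hle (by rw [hcoeff]; exact one_ne_zero)
  have hps : ∀ s : F, p.map (evalRingHom s) = C (1 - s) * f + C s * g := by
    intro s
    have hC : ((evalRingHom s).comp C : F →+* F) = RingHom.id F := by ext; simp
    simp [p, Polynomial.map_map, hC]
  let h := resultant p (derivative p) g.natDegree g.natDegree
  have hh : ∀ s : F, h.eval s = resultant (C (1 - s) * f + C s * g)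
      (derivative (C (1 - s) * f + C s * g)) g.natDegree g.natDegree := by
    intro s
    rw [← hps, derivative_map, resultant_map_map]
    rfl
  have h0 : h.eval 0 ≠ 0 := by
    have := resultant_derivative_ne_zero hf hfs
    rw [hfg] at this
    rwa [hh, sub_zero, C_1, C_0, one_mul, zero_mul, add_zero]
  have h1 : h.eval 1 ≠ 0 := by
    have := resultant_derivative_ne_zero hg hgs
    rwa [hh, sub_self, C_1, C_0, one_mul, zero_mul, zero_add]
  let R := Localization.Away h
  have : Nontrivial R := (evalAway h 0 h0).toRingHom.domain_nontrivial
  let pR := p.map (algebraMap F[X] R)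
  have hpR : pR.Monic := hp.map _
  have hpRdeg : pR.natDegree = g.natDegree := (hp.natDegree_map _).trans hpdeg
  have hpRsep : pR.Separable := by
    refine hpR.separable_of_isUnit_resultant ?_
    rw [hpRdeg, derivative_map, resultant_map_map]
    exact IsLocalization.Away.algebraMap_isUnit h
  have hspec : ∀ (s : F) (hs : h.eval s ≠ 0), pR.map (evalAway h s hs).toRingHom =
      C (1 - s) * f + C s * g := by
    intro s hs
    rw [← hps, Polynomial.map_map]
    congr 1
    exact RingHom.ext fun q => evalAway_algebraMap h s hs q
  have := etale_adjoinRoot hpR hpRsep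
  have := etale_prod R (S := AdjoinRoot pR) (T := R ⊗[F] T)
  have := etale_prod F (S := AdjoinRoot f) (T := T)
  have := etale_prod F (S := AdjoinRoot g) (T := T)
  let c := Module.finBasis F T
  let e : Fin g.natDegree ⊕ Fin (Module.finrank F T) ≃ Fin n :=
    finSumFinEquiv.trans (finCongr hn)
  refine algConnected_of_subalgebraLinked θ
    (subalgebraLinked_of_basisSpecializes θ h0 h1
      (b := ((adjoinRootBasis hpR hpRdeg).prod (c.baseChange R)).reindex e)
      (b₀ := ((adjoinRootBasis hf hfg).prod c).reindex e)
      (b₁ := ((adjoinRootBasis hg rfl).prod c).reindex e) ?_ ?_)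
  · exact ((basisSpecializes_adjoinRoot _ _ _ _ _
      (by rw [hspec, sub_zero, C_1, C_0, one_mul, zero_mul, add_zero])).prod
      (basisSpecializes_baseChange _ c)).reindex e
  · exact ((basisSpecializes_adjoinRoot _ _ _ _ _
      (by rw [hspec, sub_self, C_1, C_0, one_mul, zero_mul, zero_add])).prod
      (basisSpecializes_baseChange _ c)).reindex e

end Connected

/-! ### Finite base fields -/

section Finite

open Polynomial

variable {F : Type u} [Field F]

lemma exists_irreducible_natDegree_eq [Finite F] {m : ℕ} (hm : m ≠ 0) :
    ∃ f : F[X], f.Monic ∧ Irreducible f ∧ f.natDegree = m := by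
  have : NeZero m := ⟨hm⟩
  obtain ⟨p, hp⟩ := CharP.exists F
  have : Fact p.Prime := ⟨CharP.char_is_prime F p⟩
  obtain ⟨α, hα⟩ := Field.exists_primitive_element F (FiniteField.Extension F p m)
  have hint : IsIntegral F α := Algebra.IsIntegral.isIntegral α
  exact ⟨minpoly F α, minpoly.monic hint, minpoly.irreducible hint,
    ((Field.primitive_element_iff_minpoly_natDegree_eq F α).mp hα).trans
      (FiniteField.finrank_extension F p m)⟩

/-- If `g` does not have degree `m`, an irreducible polynomial of degree `m` is coprime to `g`. If
`g` has degree `m > 1`, it has no roots, and `X ^ m - 1` or `X ^ m - X` is separable of the same degree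
and has the root `1`. -/
lemma exists_separable_isCoprime [Finite F] {g : F[X]} (hg : g.Monic) (hgi : Irreducible g)
    (m : ℕ) :
    ∃ f : F[X], f.Monic ∧ f.Separable ∧ f.natDegree = m ∧ IsCoprime f g := by
  rcases Nat.eq_zero_or_pos m with rfl | hm
  · exact ⟨1, monic_one, separable_one, natDegree_one, isCoprime_one_left⟩
  by_cases hne : m = g.natDegree
  · rcases eq_or_lt_of_le (Nat.succ_le_of_lt hm) with h1 | h1
    · -- two different linear polynomials are coprime
      obtain ⟨a, ha⟩ : ∃ a, g = X + C a := ⟨_, hg.eq_X_add_C (hne.symm.trans h1.symm)⟩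
      refine ⟨X + C (a + 1), monic_X_add_C _, separable_X_add_C _, ?_, 1, -1, ?_⟩
      · rw [natDegree_X_add_C, ← h1]
      · rw [ha, C_add, C_1]; ring
    · have key : ∀ f : F[X], f.Monic → f.natDegree = m → f.eval 1 = 0 → IsCoprime f g := by
        intro f hf hdeg hroot
        refine (hgi.coprime_iff_not_dvd.mpr fun hdvd => ?_).symm
        have heq : f = g := eq_of_monic_of_dvd_of_natDegree_le hg hf hdvd (by omega)
        have h2 : g.natDegree = 1 := natDegree_eq_of_degree_eq_some
          (degree_eq_one_of_irreducible_of_root hgi (heq ▸ hroot : IsRoot g 1))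
        omega
      by_cases hchar : (m : F) = 0
      · have hlt : (X : F[X]).degree < (X ^ m : F[X]).degree := by
          rw [degree_X_pow, degree_X]; exact_mod_cast h1
        have hdeg : (X ^ m - X : F[X]).natDegree = m := by
          rw [natDegree_sub_eq_left_of_natDegree_lt] <;> simp [h1]
        have hmon : (X ^ m - X : F[X]).Monic := (monic_X_pow m).sub_of_left hlt
        refine ⟨X ^ m - X, hmon, ?_, hdeg, key _ hmon hdeg (by simp)⟩
        refine ⟨0, -1, ?_⟩
        simp [derivative_X_pow, hchar]
      · have hmon : (X ^ m - 1 : F[X]).Monic := monic_X_pow_sub_C 1 hm.ne'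
        have hdeg : (X ^ m - 1 : F[X]).natDegree = m := natDegree_X_pow_sub_C
        exact ⟨X ^ m - 1, hmon, X_pow_sub_one_separable_iff.mpr hchar, hdeg,
          key _ hmon hdeg (by simp)⟩
  · obtain ⟨f, hf, hfi, hdeg⟩ := exists_irreducible_natDegree_eq (F := F) hm.ne'
    refine ⟨f, hf, PerfectField.separable_of_irreducible hfi, hdeg,
      hfi.coprime_iff_not_dvd.mpr fun hdvd => hne ?_⟩
    have h := eq_of_monic_of_associated hf hg ((hfi.dvd_irreducible_iff_associated hgi).mp hdvd)
    rw [← hdeg, h]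

/-- The Chinese remainder theorem for `F[X] / (f g)`. -/
def adjoinRootMulEquiv {f g : F[X]} (h : IsCoprime f g) :
    AdjoinRoot (f * g) ≃ₐ[F] AdjoinRoot f × AdjoinRoot g :=
  AlgEquiv.ofRingEquiv (f := (Ideal.quotEquivOfEq
    (Ideal.span_singleton_mul_span_singleton f g).symm).trans
      (Ideal.quotientMulEquivQuotientProd (Ideal.span {f}) (Ideal.span {g})
        ((Ideal.isCoprime_span_singleton_iff f g).mpr h))) fun _ => rfl

/-- Moving a factor of a product of algebras. -/
def prodLeftCommEquiv (K S T : Type u) [CommRing K] [CommRing S] [CommRing T] [Algebra F K]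
    [Algebra F S] [Algebra F T] : ((K × S) × T) ≃ₐ[F] S × (K × T) where
  toFun x := (x.1.2, (x.1.1, x.2))
  invFun x := ((x.2.1, x.1), x.2.2)
  left_inv _ := rfl
  right_inv _ := rfl
  map_mul' _ _ := rfl
  map_add' _ _ := rfl
  commutes' _ := rfl

lemma finrank_adjoinRoot {f : F[X]} (hf : f.Monic) :
    Module.finrank F (AdjoinRoot f) = f.natDegree := by
  rw [Module.finrank_eq_card_basis (adjoinRootBasis hf rfl), Fintype.card_fin]

variable {A : Type u} [Ring A] [Algebra F A] {n : ℕ} (θ : A ≃ₐ[F] Matrix (Fin n) (Fin n) F)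

/-- An algebra `S` is connected to the algebras `F[X] / (f)`, with `f` separable, in the presence
of any additional factor `T`. -/
def ConnectedToAdjoinRoot (S : Type u) [CommRing S] [Algebra F S] : Prop :=
  ∀ (T : Type u) [CommRing T] [Algebra F T] [Algebra.Etale F T] (f : F[X]), f.Monic → f.Separable →
    f.natDegree = Module.finrank F S → Module.finrank F S + Module.finrank F T = n →
    AlgConnected θ (S × T) (AdjoinRoot f × T)

lemma finite_of_etale (F S : Type*) [Field F] [CommRing S] [Algebra F S] [Algebra.Etale F S] :
    Module.Finite F S :=
  Algebra.FormallyUnramified.finite_of_free F S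

lemma finrank_prod_of_etale (S T : Type*) [CommRing S] [CommRing T] [Algebra F S]
    [Algebra F T] [Algebra.Etale F S] [Algebra.Etale F T] :
    Module.finrank F (S × T) = Module.finrank F S + Module.finrank F T := by
  have := finite_of_etale F S
  have := finite_of_etale F T
  exact Module.finrank_prod

variable {θ} in
lemma AlgConnected.trans_of_finrank_eq {S T U : Type u} [CommRing S] [Algebra F S] [CommRing T]
    [Algebra F T] [CommRing U] [Algebra F U] [Algebra.Etale F T] (h : AlgConnected θ S T)
    (h' : AlgConnected θ T U) (hT : Module.finrank F T = n) : AlgConnected θ S U :=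
  have := finite_of_etale F T
  h.trans h' (Module.finBasisOfFinrankEq F T hT)

lemma connectedToAdjoinRoot_of_subsingleton (S : Type u) [CommRing S] [Algebra F S]
    [Algebra.Etale F S] [Subsingleton S] : ConnectedToAdjoinRoot θ S := by
  intro T _ _ _ f hf _ hdeg _
  obtain rfl : f = 1 := hf.natDegree_eq_zero.mp (hdeg.trans Module.finrank_zero_of_subsingleton)
  have : Subsingleton (AdjoinRoot (1 : F[X])) :=
    Ideal.Quotient.subsingleton_iff.mpr (Ideal.span_singleton_eq_top.mpr isUnit_one)
  let _ : Unique S := ⟨⟨0⟩, fun _ => Subsingleton.elim _ _⟩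
  let _ : Unique (AdjoinRoot (1 : F[X])) := ⟨⟨0⟩, fun _ => Subsingleton.elim _ _⟩
  have := etale_prod F (S := S) (T := T)
  exact algConnected_of_algEquiv θ (AlgEquiv.uniqueProd.trans AlgEquiv.uniqueProd.symm)

variable {θ} in
lemma ConnectedToAdjoinRoot.of_algEquiv {S S' : Type u} [CommRing S] [Algebra F S] [CommRing S']
    [Algebra F S'] [Algebra.Etale F S] (h : ConnectedToAdjoinRoot θ S) (e : S ≃ₐ[F] S') :
    ConnectedToAdjoinRoot θ S' := by
  intro T _ _ _ f hf hfs hdeg hn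
  rw [← e.toLinearEquiv.finrank_eq] at hdeg hn
  have : Algebra.Etale F S' := .of_equiv e
  have := etale_prod F (S := S) (T := T)
  have := etale_prod F (S := S') (T := T)
  exact (algConnected_of_algEquiv θ (AlgEquiv.prodCongr e.symm .refl)).trans_of_finrank_eq
    (h T f hf hfs hdeg hn) ((finrank_prod_of_etale S T).trans hn)

variable {θ} in
/-- The field `K` is `F[X] / (g)` for an irreducible `g`, and `S` can be replaced by `F[X] / (q)`
with `q` coprime to `g`, so that the product becomes `F[X] / (g q)`. -/
lemma ConnectedToAdjoinRoot.prod [Finite F] {K S : Type u} [Field K] [Algebra F K] [CommRing S]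
    [Algebra F S] [Algebra.Etale F K] [Algebra.Etale F S] (h : ConnectedToAdjoinRoot θ S) :
    ConnectedToAdjoinRoot θ (K × S) := by
  intro T _ _ _ f hf hfs hdeg hn
  have := finite_of_etale F K
  have : Algebra.IsSeparable F K := inferInstance
  rw [finrank_prod_of_etale] at hdeg hn
  obtain ⟨α, hα⟩ := Field.exists_primitive_element F K
  have hint : IsIntegral F α := Algebra.IsIntegral.isIntegral α
  have hdegα := (Field.primitive_element_iff_minpoly_natDegree_eq F α).mp hα
  have hα' := minpoly.monic hint
  let e : AdjoinRoot (minpoly F α) ≃ₐ[F] K :=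
    (IntermediateField.adjoinRootEquivAdjoin F hint).trans
      ((IntermediateField.equivOfEq hα).trans IntermediateField.topEquiv)
  obtain ⟨q, hq, hqs, hqdeg, hcop⟩ := exists_separable_isCoprime hα' (minpoly.irreducible hint)
    (Module.finrank F S)
  have hsep : (minpoly F α * q).Separable :=
    (Algebra.IsSeparable.isSeparable F α).mul hqs hcop.symm
  have := etale_adjoinRoot hq hqs
  have := etale_adjoinRoot (hα'.mul hq) hsep
  have := etale_prod F (S := K) (T := T)
  have := etale_prod F (S := K) (T := S)
  have := etale_prod F (S := K × S) (T := T)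
  have := etale_prod F (S := S) (T := K × T)
  have := etale_prod F (S := AdjoinRoot q) (T := K × T)
  have := etale_prod F (S := AdjoinRoot (minpoly F α * q)) (T := T)
  have hqα : (minpoly F α * q).natDegree = Module.finrank F K + Module.finrank F S := by
    rw [hα'.natDegree_mul hq, hqdeg, hdegα]
  -- split off `K`, replace `S`, and merge the two factors by the Chinese remainder theorem
  have h1 : AlgConnected θ ((K × S) × T) (S × (K × T)) :=
    algConnected_of_algEquiv θ (prodLeftCommEquiv K S T)
  have h2 : AlgConnected θ (S × (K × T)) (AdjoinRoot q × (K × T)) :=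
    h (K × T) q hq hqs hqdeg (by rw [finrank_prod_of_etale]; omega)
  have h3 : AlgConnected θ (AdjoinRoot q × (K × T)) (AdjoinRoot (minpoly F α * q) × T) :=
    (algConnected_of_algEquiv θ ((AlgEquiv.prodCongr ((adjoinRootMulEquiv hcop.symm).trans
      (AlgEquiv.prodCongr e .refl)) .refl).trans (prodLeftCommEquiv K _ T))).symm
  have h4 : AlgConnected θ (AdjoinRoot (minpoly F α * q) × T) (AdjoinRoot f × T) :=
    algConnected_adjoinRoot_prod θ (hα'.mul hq) hf hsep hfs (hqα.trans hdeg.symm)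
      (by rw [hdeg, hn])
  exact ((h1.trans_of_finrank_eq h2
    (by simp only [finrank_prod_of_etale]; omega)).trans_of_finrank_eq h3
    (by simp only [finrank_prod_of_etale, finrank_adjoinRoot hq]; omega)).trans_of_finrank_eq h4
      (by rw [finrank_prod_of_etale, finrank_adjoinRoot (hα'.mul hq)]; omega)

/-- An étale algebra is a product of fields, and these are split off one after the other. -/
lemma connectedToAdjoinRoot_of_etale [Finite F] (S : Type u) [CommRing S] [Algebra F S]
    [Algebra.Etale F S] : ConnectedToAdjoinRoot θ S := by
  obtain ⟨I, _, K, _, _, ε, hK⟩ := (Algebra.Etale.iff_exists_algEquiv_prod F S).mp inferInstance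
  have hK' : ∀ i, Algebra.Etale F (K i) := fun i =>
    have := (hK i).1
    have := (hK i).2
    have := Algebra.FormallyEtale.of_isSeparable F (K i)
    ⟨inferInstance, Algebra.FinitePresentation.of_finiteType.mp inferInstance⟩
  suffices H : ∀ (I : Type u) [Finite I] (K : I → Type u) [∀ i, Field (K i)]
      [∀ i, Algebra F (K i)] [∀ i, Algebra.Etale F (K i)],
      ConnectedToAdjoinRoot θ (∀ i, K i) from (H I K).of_algEquiv ε.symm
  intro I hI
  have hI' := hI
  revert hI'
  induction I using Finite.induction_empty_option with
  | of_equiv e ih =>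
    intro _ K _ _ _
    have := Finite.of_equiv _ e.symm
    exact (ih this fun i => K (e i)).of_algEquiv (AlgEquiv.piCongrLeft F K e)
  | h_empty =>
    intro _ K _ _ _
    exact connectedToAdjoinRoot_of_subsingleton θ _
  | h_option ih =>
    intro _ K _ _ _
    have := etale_prod F (S := K none) (T := ∀ i, K (some i))
    exact ((ih inferInstance fun i => K (some i)).prod (K := K none)).of_algEquiv
      (AlgEquiv.ofRingEquiv (f := RingEquiv.piOptionEquivProd) fun _ => rfl).symm

lemma algConnected_of_finite [Finite F] {S T : Type u} [CommRing S] [Algebra F S]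
    [Algebra.Etale F S] [CommRing T] [Algebra F T] [Algebra.Etale F T]
    (hS : Module.finrank F S = n) (hT : Module.finrank F T = n) : AlgConnected θ S T := by
  obtain ⟨f, hf, hfs, hdeg, -⟩ := exists_separable_isCoprime (F := F) monic_X irreducible_X n
  -- the zero algebra as the additional factor
  let Z := AdjoinRoot (1 : F[X])
  have : Subsingleton Z :=
    Ideal.Quotient.subsingleton_iff.mpr (Ideal.span_singleton_eq_top.mpr isUnit_one)
  let _ : Unique Z := ⟨⟨0⟩, fun _ => Subsingleton.elim _ _⟩
  have : Algebra.Etale F Z := etale_adjoinRoot monic_one separable_one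
  have := etale_adjoinRoot hf hfs
  have := etale_prod F (S := AdjoinRoot f) (T := Z)
  have hZ : Module.finrank F Z = 0 := Module.finrank_zero_of_subsingleton
  have key : ∀ (S : Type u) [CommRing S] [Algebra F S] [Algebra.Etale F S],
      Module.finrank F S = n → AlgConnected θ S (AdjoinRoot f × Z) := by
    intro S _ _ _ hS
    have := etale_prod F (S := S) (T := Z)
    exact (algConnected_of_algEquiv θ AlgEquiv.prodUnique.symm).trans_of_finrank_eq
      (connectedToAdjoinRoot_of_etale θ S Z f hf hfs (hdeg.trans hS.symm)
        (by rw [hS, hZ, add_zero]))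
      (by rw [finrank_prod_of_etale, hS, hZ, add_zero])
  exact (key S hS).trans_of_finrank_eq (key T hT).symm
    (by rw [finrank_prod_of_etale, hZ, finrank_adjoinRoot hf, hdeg, add_zero])

variable [Algebra.IsCentral F A] [IsSimpleRing A] [FiniteDimensional F A]

lemma isRTrivial_et_of_finite [Finite F] (hn : Module.finrank F A = n ^ 2) :
    IsRTrivial (et F A n n) := by
  obtain ⟨θ⟩ := exists_algEquiv_matrix_of_finite hn
  refine isRTrivial_et hn ?_ fun E₀ E₁ h₀ hr₀ h₁ hr₁ => ?_
  · obtain ⟨f, hf, hfs, hdeg, -⟩ := exists_separable_isCoprime (F := F) monic_X irreducible_X n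
    have := etale_adjoinRoot hf hfs
    obtain ⟨hE, ⟨b⟩⟩ := isEtaleSubalgebra_range_mulEmbedding θ (adjoinRootBasis hf hdeg)
    exact ⟨_, hE, by rw [Module.finrank_eq_card_basis b, Fintype.card_fin]⟩
  · obtain ⟨S, _, _, _, b, rfl⟩ := h₀.exists_eq_range_mulEmbedding θ hr₀
    obtain ⟨T, _, _, _, c, rfl⟩ := h₁.exists_eq_range_mulEmbedding θ hr₁
    exact algConnected_of_finite θ (by rw [Module.finrank_eq_card_basis b, Fintype.card_fin])
      (by rw [Module.finrank_eq_card_basis c, Fintype.card_fin]) b c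

end Finite

end

theorem mainTheorem9 (F : Type u) [Field F] (A : Type u) [Ring A] [Algebra F A]
    [Algebra.IsCentral F A] [IsSimpleRing A] [FiniteDimensional F A]
    (n : ℕ) (hn : Module.finrank F A = n ^ 2) :
    IsRTrivial (et F A n n) ∧
    ∀ X : Over (Spec (CommRingCat.of F)),
      Nonempty ((et F A n n).RepresentableBy X) → SchemeIsRTrivial X := by
  have h : IsRTrivial (et F A n n) := by
    rcases finite_or_infinite F with _ | _
    · exact isRTrivial_et_of_finite hn
    · exact isRTrivial_et_of_infinite hn
  exact ⟨h, fun X ⟨r⟩ => schemeIsRTrivial_of_representableBy r h⟩
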